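/- Let $M$ be a smooth manifold of dimension $m$ (Hausdorff, second countable, without boundary), let $\nabla$ be a smooth torsion free connection on its tangent bundle, and let $\mu\in\mathbb{R}$. For a $C^2$ function $f$ let $\mathcal{H}_\nabla f(X,Y)=X(Yf)-(\nabla_XY)f$ be the Hessian. Let $R_\nabla(X,Y)=\nabla_X\nabla_Y-\nabla_Y\nabla_X-\nabla_{[X,Y]}$, let $\rho_\nabla(x,y)=\operatorname{Tr}\{z\mapsto R_\nabla(z,x)y\}$ be the Ricci tensor, and let $\rho_{s,\nabla}(x,y)=\frac12\{\rho_\nabla(x,y)+\rho_\nabla(y,x)\}$. The affine quasi-Einstein equation is $$\mathcal{H}_\nabla f=\mu f\rho_{s,\nabla}.\qquad(*)$$ Let $E(\mu,\nabla)$ be the space of all $f\in C^2(M)$ which satisfy $(*)$ on $M$, and for $P\in M$ let $E(P,\mu,\nabla)$ be the space of germs at $P$ of smooth real functions which satisfy $(*)$ near $P$. Then the following hold. 1. If $f$ is a $C^2$ function on an open set $U\subseteq M$ which satisfies $(*)$ on $U$, then $f\in C^\infty(U)$. If in addition $M$ and $\nabla$ are real analytic, then $f$ is real analytic on $U$. 2.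 If $X$ is the germ at $P$ of an affine Killing vector field (a smooth vector field near $P$ with $[X,\nabla_YZ]=\nabla_{[X,Y]}Z+\nabla_Y[X,Z]$ for all local smooth vector fields $Y,Z$) and if $f\in E(P,\mu,\nabla)$, then $Xf\in E(P,\mu,\nabla)$. 3. If $f\in E(P,\mu,\nabla)$, $f(P)=0$ and $df(P)=0$, then $f\equiv0$ near $P$. 4. For every $P\in M$, the space $E(P,\mu,\nabla)$ is finite dimensional and $\dim E(P,\mu,\nabla)\le m+1$. 5. If $M$ is simply connected (in particular connected) and $\dim E(Q,\mu,\nabla)$ is the same for all $Q\in M$, then for every $P\in M$ and every $f\in E(P,\mu,\nabla)$ there is exactly one $F\in E(\mu,\nabla)$ whose germ at $P$ is $f$. -/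

import Mathlib

open Set Filter Topology Bundle VectorField
open scoped Manifold ContDiff

noncomputable section

/-- The model space `ℝ^m`. -/
abbrev Coord (m : ℕ) : Type := EuclideanSpace ℝ (Fin m)

/-- A smooth torsion free connection on the tangent bundle of a smooth `m`-manifold `M`.
As in Mathlib, `toFun Y x v` stands for `(∇_v Y)(x)`. Smoothness: `∇ Y` is smooth on every open
set on which the vector field `Y` is smooth. -/
structure AffineConnection (m : ℕ) (M : Type*) [TopologicalSpace M] [ChartedSpace (Coord m) M]
    [IsManifold (𝓡 m) ∞ M] extends
    CovariantDerivative (𝓡 m) (Coord m) (TangentSpace (𝓡 m) : M → Type _) where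
  smooth : ∀ U : Set M, IsOpen U → ContMDiffCovariantDerivativeOn (Coord m) ∞ toFun U
  torsion_eq_zero : toCovariantDerivative.torsion = 0

namespace AffineConnection

variable {m : ℕ} {M : Type*} [TopologicalSpace M] [ChartedSpace (Coord m) M]
  [IsManifold (𝓡 m) ∞ M]

/-- The vector field `∇_X Y`. -/
def nabla (D : AffineConnection m M) (X Y : Π x : M, TangentSpace (𝓡 m) x) :
    Π x : M, TangentSpace (𝓡 m) x :=
  fun x ↦ D.toFun Y x (X x)

/-- The connection is real analytic: on every open set on which `Y` is real analytic, so
is `∇ Y`. This is used only when the atlas of `M` is real analytic. -/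
def IsAnalytic (D : AffineConnection m M) : Prop :=
  ∀ U : Set M, IsOpen U → ContMDiffCovariantDerivativeOn (Coord m) ω D.toFun U

/-- The vector field near `x` with value `v` at `x` whose components are constant in the
preferred chart at `x`. -/
def constField {x : M} (v : TangentSpace (𝓡 m) x) : Π y : M, TangentSpace (𝓡 m) y :=
  FiberBundle.extend (Coord m) v

/-- The Hessian `(H_∇ f)(v, w) = v(W f) - (∇_v W) f`, where `W` is a vector field extending `w`.
In coordinates this is `(∂_i ∂_j f - Γ_ij^k ∂_k f) v^i w^j`. -/
def hessian (D : AffineConnection m M) (f : M → ℝ) (x : M) (v w : TangentSpace (𝓡 m) x) : ℝ :=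
  mvfderiv (𝓡 m) (fun y ↦ mvfderiv (𝓡 m) f y (constField w y)) x v -
    mvfderiv (𝓡 m) f x (D.toFun (constField w) x v)

/-- The curvature `R(X, Y) Z = ∇_X ∇_Y Z - ∇_Y ∇_X Z - ∇_[X,Y] Z` on vector fields. -/
def curvature (D : AffineConnection m M) (X Y Z : Π x : M, TangentSpace (𝓡 m) x) :
    Π x : M, TangentSpace (𝓡 m) x :=
  D.nabla X (D.nabla Y Z) - D.nabla Y (D.nabla X Z) - D.nabla (mlieBracket (𝓡 m) X Y) Z

/-- The Ricci tensor `ρ(v, w) = Tr (z ↦ R(z, v) w)`; the trace is computed in the standard basis of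
`T_x M = ℝ^m`, and vectors are extended to vector fields to evaluate the curvature tensor. -/
def ricci (D : AffineConnection m M) (x : M) (v w : TangentSpace (𝓡 m) x) : ℝ :=
  ∑ i : Fin m,
    let e : TangentSpace (𝓡 m) x := (EuclideanSpace.single i 1 : Coord m)
    let r : Coord m := D.curvature (constField e) (constField v) (constField w) x
    r i

/-- The symmetric Ricci tensor `ρ_s`. -/
def ricciSymm (D : AffineConnection m M) (x : M) (v w : TangentSpace (𝓡 m) x) : ℝ :=
  (1 / 2) * (D.ricci x v w + D.ricci x w v)

/-- `f` satisfies the affine quasi-Einstein equation `H_∇ f = μ f ρ_s` at every point of `U`. -/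
def QuasiEinsteinOn (D : AffineConnection m M) (μ : ℝ) (f : M → ℝ) (U : Set M) : Prop :=
  ∀ x ∈ U, ∀ v w : TangentSpace (𝓡 m) x, D.hessian f x v w = μ * f x * D.ricciSymm x v w

/-- The vector field `X` represents the germ at `P` of an affine Killing vector field: near `P` it
is smooth and `L_X ∇ = 0`, i.e. `[X, ∇_Y Z] = ∇_[X,Y] Z + ∇_Y [X, Z]` for all local smooth vector
fields `Y` and `Z`. -/
def IsAffineKillingNear (D : AffineConnection m M) (X : Π x : M, TangentSpace (𝓡 m) x) (P : M) :
    Prop :=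
  ∃ U : Set M, IsOpen U ∧ P ∈ U ∧
    ContMDiffOn (𝓡 m) ((𝓡 m).prod (𝓡 m)) ∞ (fun x ↦ (X x : TangentBundle (𝓡 m) M)) U ∧
    ∀ V : Set M, IsOpen V → V ⊆ U → ∀ Y Z : Π x : M, TangentSpace (𝓡 m) x,
      ContMDiffOn (𝓡 m) ((𝓡 m).prod (𝓡 m)) ∞ (fun x ↦ (Y x : TangentBundle (𝓡 m) M)) V →
      ContMDiffOn (𝓡 m) ((𝓡 m).prod (𝓡 m)) ∞ (fun x ↦ (Z x : TangentBundle (𝓡 m) M)) V →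
      ∀ x ∈ V, mlieBracket (𝓡 m) X (D.nabla Y Z) x =
        D.nabla (mlieBracket (𝓡 m) X Y) Z x + D.nabla Y (mlieBracket (𝓡 m) X Z) x

lemma mdifferentiableAt_mvfderiv_constField {f : M → ℝ} {x : M}
    (hf : ContMDiffAt (𝓡 m) 𝓘(ℝ, ℝ) 2 f x) (w : TangentSpace (𝓡 m) x) :
    MDifferentiableAt (𝓡 m) 𝓘(ℝ, ℝ) (fun y ↦ mvfderiv (𝓡 m) f y (constField w y)) x := by
  have h1 := ContMDiffAt.mfderiv_const (m := 1) hf (by norm_num)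
  have h2 : ContMDiffAt (𝓡 m) ((𝓡 m).prod (𝓡 m)) 1
      (fun y ↦ (constField w y : TangentBundle (𝓡 m) M)) x :=
    FiberBundle.contMDiffAt_extend (k := 1) (𝓡 m) (Coord m) w
  have h3 := ContMDiffAt.clm_apply_of_inCoordinates h1 h2 (hf.of_le (by norm_num))
  exact ((contMDiff_snd_tangentBundle_modelSpace ℝ 𝓘(ℝ, ℝ)).contMDiffAt.comp x h3).mdifferentiableAt
    one_ne_zero

lemma mvfderiv_congr {f g : M → ℝ} {x : M} (h : f =ᶠ[𝓝 x] g) :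
    mvfderiv (𝓡 m) f x = mvfderiv (𝓡 m) g x := by
  ext v
  change (mfderiv (𝓡 m) 𝓘(ℝ, ℝ) f x : TangentSpace (𝓡 m) x →L[ℝ] ℝ) v =
    (mfderiv (𝓡 m) 𝓘(ℝ, ℝ) g x : TangentSpace (𝓡 m) x →L[ℝ] ℝ) v
  rw [h.mfderiv_eq]
  rfl

lemma hessian_add (D : AffineConnection m M) {f g : M → ℝ} {U : Set M} (hU : IsOpen U)
    (hf : ContMDiffOn (𝓡 m) 𝓘(ℝ, ℝ) 2 f U) (hg : ContMDiffOn (𝓡 m) 𝓘(ℝ, ℝ) 2 g U)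
    {x : M} (hx : x ∈ U) (v w : TangentSpace (𝓡 m) x) :
    D.hessian (f + g) x v w = D.hessian f x v w + D.hessian g x v w := by
  have hf' : ∀ y ∈ U, ContMDiffAt (𝓡 m) 𝓘(ℝ, ℝ) 2 f y :=
    fun y hy ↦ hf.contMDiffAt (hU.mem_nhds hy)
  have hg' : ∀ y ∈ U, ContMDiffAt (𝓡 m) 𝓘(ℝ, ℝ) 2 g y :=
    fun y hy ↦ hg.contMDiffAt (hU.mem_nhds hy)
  have hd : ∀ y ∈ U, mvfderiv (𝓡 m) (f + g) y = mvfderiv (𝓡 m) f y + mvfderiv (𝓡 m) g y :=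
    fun y hy ↦ mvfderiv_add ((hf' y hy).mdifferentiableAt two_ne_zero)
      ((hg' y hy).mdifferentiableAt two_ne_zero)
  have he : (fun y ↦ mvfderiv (𝓡 m) (f + g) y (constField w y)) =ᶠ[𝓝 x]
      (fun y ↦ mvfderiv (𝓡 m) f y (constField w y)) +
        (fun y ↦ mvfderiv (𝓡 m) g y (constField w y)) := by
    filter_upwards [hU.mem_nhds hx] with y hy
    rw [hd y hy]; rfl
  have h2 : mvfderiv (𝓡 m) (fun y ↦ mvfderiv (𝓡 m) (f + g) y (constField w y)) x =
      mvfderiv (𝓡 m) (fun y ↦ mvfderiv (𝓡 m) f y (constField w y)) x +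
        mvfderiv (𝓡 m) (fun y ↦ mvfderiv (𝓡 m) g y (constField w y)) x := by
    rw [← mvfderiv_add (mdifferentiableAt_mvfderiv_constField (hf' x hx) w)
      (mdifferentiableAt_mvfderiv_constField (hg' x hx) w)]
    exact mvfderiv_congr he
  simp only [hessian, h2, hd x hx, add_apply]
  ring

lemma hessian_smul (D : AffineConnection m M) (c : ℝ) {f : M → ℝ} {U : Set M} (hU : IsOpen U)
    (hf : ContMDiffOn (𝓡 m) 𝓘(ℝ, ℝ) 2 f U)
    {x : M} (hx : x ∈ U) (v w : TangentSpace (𝓡 m) x) :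
    D.hessian (c • f) x v w = c * D.hessian f x v w := by
  have key : ∀ {h : M → ℝ} {y : M}, MDifferentiableAt (𝓡 m) 𝓘(ℝ, ℝ) h y →
      mvfderiv (𝓡 m) (c • h) y = c • mvfderiv (𝓡 m) h y := by
    intro h y hh
    have := mvfderiv_smul (I := 𝓡 m) (a := fun _ : M ↦ c)
      (mdifferentiableAt_const (c := c)) hh
    rw [mvfderiv_const] at this
    change mvfderiv (𝓡 m) ((fun _ : M ↦ c) • h) y = _
    rw [this]
    simp
  have hf' : ∀ y ∈ U, ContMDiffAt (𝓡 m) 𝓘(ℝ, ℝ) 2 f y :=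
    fun y hy ↦ hf.contMDiffAt (hU.mem_nhds hy)
  have hd : ∀ y ∈ U, mvfderiv (𝓡 m) (c • f) y = c • mvfderiv (𝓡 m) f y :=
    fun y hy ↦ key ((hf' y hy).mdifferentiableAt two_ne_zero)
  have he : (fun y ↦ mvfderiv (𝓡 m) (c • f) y (constField w y)) =ᶠ[𝓝 x]
      c • (fun y ↦ mvfderiv (𝓡 m) f y (constField w y)) := by
    filter_upwards [hU.mem_nhds hx] with y hy
    rw [hd y hy]; rfl
  have h2 : mvfderiv (𝓡 m) (fun y ↦ mvfderiv (𝓡 m) (c • f) y (constField w y)) x =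
      c • mvfderiv (𝓡 m) (fun y ↦ mvfderiv (𝓡 m) f y (constField w y)) x := by
    rw [← key (mdifferentiableAt_mvfderiv_constField (hf' x hx) w)]
    exact mvfderiv_congr he
  simp only [hessian, h2, hd x hx, smul_apply, smul_eq_mul]
  ring

lemma hessian_zero (D : AffineConnection m M) (x : M) (v w : TangentSpace (𝓡 m) x) :
    D.hessian (0 : M → ℝ) x v w = 0 := by
  have h := D.hessian_smul 0 (f := 0) isOpen_univ (contMDiff_const (c := (0 : ℝ))).contMDiffOn
    (mem_univ x) v w
  simpa using h

lemma QuasiEinsteinOn.add {D : AffineConnection m M} {μ : ℝ} {f g : M → ℝ} {U : Set M}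
    (hU : IsOpen U) (hf : ContMDiffOn (𝓡 m) 𝓘(ℝ, ℝ) 2 f U)
    (hg : ContMDiffOn (𝓡 m) 𝓘(ℝ, ℝ) 2 g U)
    (hf' : D.QuasiEinsteinOn μ f U) (hg' : D.QuasiEinsteinOn μ g U) :
    D.QuasiEinsteinOn μ (f + g) U := by
  intro x hx v w
  rw [D.hessian_add hU hf hg hx, hf' x hx, hg' x hx, Pi.add_apply]
  ring

lemma QuasiEinsteinOn.smul {D : AffineConnection m M} {μ : ℝ} (c : ℝ) {f : M → ℝ} {U : Set M}
    (hU : IsOpen U) (hf : ContMDiffOn (𝓡 m) 𝓘(ℝ, ℝ) 2 f U) (hf' : D.QuasiEinsteinOn μ f U) :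
    D.QuasiEinsteinOn μ (c • f) U := by
  intro x hx v w
  rw [D.hessian_smul c hU hf hx, hf' x hx, Pi.smul_apply, smul_eq_mul]
  ring

lemma QuasiEinsteinOn.zero (D : AffineConnection m M) (μ : ℝ) (U : Set M) :
    D.QuasiEinsteinOn μ 0 U := by
  intro x _ v w
  simp [hessian_zero]

/-- The space `E(μ, ∇)` of all `C^2` functions on `M` which satisfy `H_∇ f = μ f ρ_s`. -/
def solutions (D : AffineConnection m M) (μ : ℝ) : Submodule ℝ (M → ℝ) where
  carrier := {f | ContMDiff (𝓡 m) 𝓘(ℝ, ℝ) 2 f ∧ D.QuasiEinsteinOn μ f univ}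
  add_mem' hf hg := ⟨hf.1.add hg.1, .add isOpen_univ hf.1.contMDiffOn hg.1.contMDiffOn hf.2 hg.2⟩
  zero_mem' := ⟨contMDiff_const, .zero D μ univ⟩
  smul_mem' c _ hf := ⟨(contDiff_const_smul c).contMDiff.comp hf.1, .smul c isOpen_univ hf.1.contMDiffOn hf.2⟩

/-- The space `E(P, μ, ∇)` of all germs at `P` of smooth functions, defined near `P`, which satisfy
`H_∇ f = μ f ρ_s` near `P`. -/
def germSolutions (D : AffineConnection m M) (μ : ℝ) (P : M) : Submodule ℝ (Germ (𝓝 P) ℝ) where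
  carrier := {φ | ∃ (U : Set M) (f : M → ℝ), IsOpen U ∧ P ∈ U ∧
    ContMDiffOn (𝓡 m) 𝓘(ℝ, ℝ) ∞ f U ∧ D.QuasiEinsteinOn μ f U ∧ (f : Germ (𝓝 P) ℝ) = φ}
  add_mem' := by
    rintro _ _ ⟨U, f, hU, hPU, hf, hf', rfl⟩ ⟨V, g, hV, hPV, hg, hg', rfl⟩
    have hf1 := hf.mono (inter_subset_left (s := U) (t := V))
    have hg1 := hg.mono (inter_subset_right (s := U) (t := V))
    refine ⟨U ∩ V, f + g, hU.inter hV, ⟨hPU, hPV⟩, hf1.add hg1, ?_, Germ.coe_add f g⟩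
    exact .add (hU.inter hV) (hf1.of_le ENat.LEInfty.out) (hg1.of_le ENat.LEInfty.out)
      (fun x hx ↦ hf' x hx.1) (fun x hx ↦ hg' x hx.2)
  zero_mem' := ⟨univ, 0, isOpen_univ, mem_univ P, contMDiffOn_const, .zero D μ univ, rfl⟩
  smul_mem' := by
    rintro c _ ⟨U, f, hU, hPU, hf, hf', rfl⟩
    exact ⟨U, c • f, hU, hPU, (contDiff_const_smul c).contMDiff.comp_contMDiffOn hf,
       .smul c hU (hf.of_le ENat.LEInfty.out) hf',
      Germ.coe_smul c f⟩

end AffineConnection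

end

/-! In a chart with Christoffel symbols Γ the equation reads ∂_i∂_j f = Γ_ij^k ∂_k f + μ f (ρ_s)_ij.
It prescribes every second derivative as a linear expression in f and df, so the 1-jet J = (f, df)
solves a closed linear total system dJ = A J (`IsSolutionAt.hasFDerivAt_jet`). The coefficients A
are built from Γ and its first derivatives, hence are smooth or analytic when Γ is.

All assertions except the one on Killing fields rest on this system. Regularity is a bootstrap in
the smooth case (`LinearTotalSystem.contDiffOn_infty`). In the analytic case
(`LinearTotalSystem.analyticAt`), J on the ray t ↦ x + tv solves a Volterra equation (1 - K(v)) y =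
J(x), where K(v) depends analytically on v and K(0) = 0; inverting 1 - K(v) and evaluating at time 1
shows that J(x + v) is analytic in v. On a segment the system is a linear ODE, so a solution whose
jet vanishes at one point vanishes on every convex coordinate domain containing that point
(`LinearTotalSystem.eq_zero_of_convex`). Hence a germ is determined by its 1-jet, an element of a
space of dimension m + 1, and unique continuation holds along connected sets
(`QuasiEinsteinOn.eq_zero_of_isPreconnected`).

A Killing field X preserves Γ, hence the curvature and the Ricci tensor
(`IsKillingAt.fderiv_ricci`). Differentiating the equation along X then yields the same equation for
Xf (`IsSolutionAt.killing`).

For the extension theorem, representatives of a basis of germs at P live on a common coordinate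
ball, and unique continuation keeps them independent at each of its points. If the dimension is
constant they stay a basis (`bijOn_germSolutions`). The germs of solutions thus form a locally
constant system, that is, a covering of M with discrete fibre. Over a simply connected base it has a
section through any prescribed germ (`exists_global_of_germs`). -/

section

set_option maxSynthPendingDepth 3

/-! ### Linear total systems dF = A F: uniqueness and smoothness -/

namespace LinearTotalSystem

variable {E G : Type*} [NormedAddCommGroup E] [NormedSpace ℝ E] [NormedAddCommGroup G]
  [NormedSpace ℝ G] {A : E → E →L[ℝ] G →L[ℝ] G} {F : E → G} {s : Set E}

/-- A solution along a segment, as a solution of an ordinary differential equation. -/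
lemma hasDerivAt_segment {x v : E} {t : ℝ}
    (hF : HasFDerivAt F ((A (x + t • v)).flip (F (x + t • v))) (x + t • v)) :
    HasDerivAt (fun t : ℝ ↦ F (x + t • v)) (A (x + t • v) v (F (x + t • v))) t := by
  have h : HasDerivAt (fun t : ℝ ↦ x + t • v) v t := by
    simpa using ((hasDerivAt_id t).smul_const v).const_add x
  exact hF.comp_hasDerivAt t h

/-- Join the two points by a segment inside `s`. There the system is a linear ODE whose coefficient
is bounded by compactness, and Gronwall's inequality applies. -/
theorem eq_zero_of_convex (hs : Convex ℝ s) (hA : ContinuousOn A s)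
    (hF : ∀ x ∈ s, HasFDerivAt F ((A x).flip (F x)) x) {x₀ : E} (h₀ : x₀ ∈ s) (hz : F x₀ = 0) :
    ∀ x ∈ s, F x = 0 := by
  intro x hx
  set v := x - x₀
  have hγ : ∀ t ∈ Icc (0 : ℝ) 1, x₀ + t • v ∈ s := fun t ht ↦
    hs.add_smul_sub_mem h₀ hx ht
  have hcA : ContinuousOn (fun t : ℝ ↦ A (x₀ + t • v) v) (Icc 0 1) :=
    (hA.comp (by fun_prop) hγ).clm_apply continuousOn_const
  obtain ⟨K, hK⟩ := isCompact_Icc.exists_bound_of_continuousOn (E := G →L[ℝ] G) hcA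
  have hd : ∀ t ∈ Icc (0 : ℝ) 1, HasDerivAt (fun t : ℝ ↦ F (x₀ + t • v))
      (A (x₀ + t • v) v (F (x₀ + t • v))) t := fun t ht ↦ hasDerivAt_segment (hF _ (hγ t ht))
  have := eq_zero_of_abs_deriv_le_mul_abs_self_of_eq_zero_right (K := K)
    (fun t ht ↦ (hd t ht).continuousAt.continuousWithinAt)
    (fun t ht ↦ (hd t (Ico_subset_Icc_self ht)).hasDerivWithinAt) (by simpa using hz)
    (fun t ht ↦ (A (x₀ + t • v) v).le_of_opNorm_le (hK t (Ico_subset_Icc_self ht)) _)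
    1 (right_mem_Icc.2 zero_le_one)
  simpa [v] using this

/-- Bootstrap: if F is C^n, then so is dF = A F, hence F is C^(n+1). -/
theorem contDiffOn_infty (hs : IsOpen s) (hA : ContDiffOn ℝ ∞ A s)
    (hF : ∀ x ∈ s, HasFDerivAt F ((A x).flip (F x)) x) : ContDiffOn ℝ ∞ F s := by
  rw [_root_.contDiffOn_infty]
  intro n
  induction n with
  | zero =>
    exact contDiffOn_zero.2 fun x hx ↦ (hF x hx).continuousAt.continuousWithinAt
  | succ n ih =>
    push_cast
    rw [contDiffOn_succ_iff_fderiv_of_isOpen hs]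
    refine ⟨fun x hx ↦ (hF x hx).differentiableAt.differentiableWithinAt, by simp, ?_⟩
    refine ContDiffOn.congr (f := fun x ↦ (A x).flip (F x)) ?_ fun x hx ↦ (hF x hx).fderiv
    refine ContDiffOn.clm_apply (F := G) (G := E →L[ℝ] G) ?_ ih
    have hA' : ContDiffOn ℝ n A s := hA.of_le (by exact_mod_cast (le_top (a := (n : ℕ∞))))
    exact (LinearIsometryEquiv.contDiff (F := G →L[ℝ] E →L[ℝ] G)
      (ContinuousLinearMap.flipₗᵢ ℝ E G G)).comp_contDiffOn hA'

end LinearTotalSystem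

/-! ### Analytic families in the Banach space of continuous paths -/

section PathSpace

variable {X Y : Type*} [NormedAddCommGroup X] [NormedSpace ℝ X]
  [NormedAddCommGroup Y] [NormedSpace ℝ Y]

/-- The primitive vanishing at `0` of a continuous path on the unit interval. -/
noncomputable def pathPrimitive [CompleteSpace X] : C(unitInterval, X) →L[ℝ] C(unitInterval, X) :=
  LinearMap.mkContinuous
    { toFun := fun y ↦ ⟨fun t ↦ ∫ s in (0 : ℝ)..t, IccExtend zero_le_one y s,
        (intervalIntegral.continuous_primitive (fun a b ↦
          (y.continuous.Icc_extend' (h := zero_le_one)).intervalIntegrable a b) 0).comp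
          continuous_subtype_val⟩
      map_add' := fun y z ↦ by
        ext t
        exact intervalIntegral.integral_add
          ((y.continuous.Icc_extend' (h := zero_le_one)).intervalIntegrable _ _)
          ((z.continuous.Icc_extend' (h := zero_le_one)).intervalIntegrable _ _)
      map_smul' := fun c y ↦ by
        ext t
        exact intervalIntegral.integral_smul c _ } 1 fun y ↦ by
    rw [one_mul, ContinuousMap.norm_le _ (norm_nonneg _)]
    intro t
    refine (intervalIntegral.norm_integral_le_of_norm_le_const (C := ‖y‖) fun s _ ↦
      y.norm_coe_le_norm _).trans ?_
    rw [sub_zero, abs_of_nonneg t.2.1]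
    exact mul_le_of_le_one_right (norm_nonneg _) t.2.2

lemma pathPrimitive_apply [CompleteSpace X] (y : C(unitInterval, X)) (t : unitInterval) :
    pathPrimitive y t = ∫ s in (0 : ℝ)..t, IccExtend zero_le_one y s := rfl

/-- Pointwise application of a path of operators to a path of vectors. -/
noncomputable def pathApply :
    C(unitInterval, X →L[ℝ] Y) →L[ℝ] C(unitInterval, X) →L[ℝ] C(unitInterval, Y) :=
  LinearMap.mkContinuous₂ (E := C(unitInterval, X →L[ℝ] Y)) (F := C(unitInterval, X))
    (G := C(unitInterval, Y))
    (LinearMap.mk₂ ℝ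
      (fun (B : C(unitInterval, X →L[ℝ] Y)) (y : C(unitInterval, X)) ↦
        (⟨fun s ↦ B s (y s), by fun_prop⟩ : C(unitInterval, Y)))
      (fun _ _ _ ↦ by ext; simp) (fun _ _ _ ↦ by ext; simp)
      (fun _ _ _ ↦ by ext; simp) (fun _ _ _ ↦ by ext; simp)) 1 fun B y ↦ by
    rw [one_mul, ContinuousMap.norm_le _ (by positivity)]
    intro t
    exact (B t).le_of_opNorm_le_of_le (B.norm_coe_le_norm t) (y.norm_coe_le_norm t)

/-- The path `s ↦ s ^ n • a`. -/
noncomputable def pathMonomial (n : ℕ) : X →L[ℝ] C(unitInterval, X) :=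
  LinearMap.mkContinuous
    { toFun := fun a ↦ ⟨fun s ↦ (s : ℝ) ^ n • a, by fun_prop⟩
      map_add' := fun a b ↦ by ext; simp
      map_smul' := fun c a ↦ by ext s; exact smul_comm _ _ _ } 1 fun a ↦ by
    rw [one_mul, ContinuousMap.norm_le _ (norm_nonneg _)]
    intro s
    change ‖(s : ℝ) ^ n • a‖ ≤ _
    rw [norm_smul, norm_pow, Real.norm_of_nonneg s.2.1]
    exact mul_le_of_le_one_left (norm_nonneg _) (pow_le_one₀ s.2.1 s.2.2)

/-- Restriction of an analytic map to the rays at a point depends analytically on the direction,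
as a map into the space of continuous paths. -/
lemma AnalyticAt.exists_path [CompleteSpace Y] {f : X → Y} {x : X} (hf : AnalyticAt ℝ f x) :
    ∃ B : X → C(unitInterval, Y), AnalyticAt ℝ B 0 ∧
      ∀ᶠ v in 𝓝 (0 : X), ∀ s : unitInterval, B v s = f (x + (s : ℝ) • v) := by
  obtain ⟨p, r, hp⟩ := hf
  -- On the ray s ↦ sv the term of degree n is s^n p_n(v, ..., v). Reading it as a path-valued
  -- multilinear map does not increase norms, since |s| ≤ 1, so the new series converges at least
  -- where the old one does.
  let q : FormalMultilinearSeries ℝ X C(unitInterval, Y) :=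
    fun n ↦ (pathMonomial n).compContinuousMultilinearMap (p n)
  have hq : p.radius ≤ q.radius := by
    refine FormalMultilinearSeries.radius_le_of_le fun n ↦ ?_
    refine (ContinuousLinearMap.norm_compContinuousMultilinearMap_le _ _).trans ?_
    exact mul_le_of_le_one_left (norm_nonneg _)
      (LinearMap.mkContinuous_norm_le _ zero_le_one _)
  have hr : 0 < q.radius := hp.r_pos.trans_le (hp.r_le.trans hq)
  have hqs := q.hasFPowerSeriesOnBall hr
  refine ⟨q.sum, ⟨q, hqs.hasFPowerSeriesAt⟩, ?_⟩
  filter_upwards [Metric.eball_mem_nhds (0 : X) hp.r_pos] with v hv s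
  have h1 := hqs.hasSum (y := v) (Metric.eball_subset_eball (hp.r_le.trans hq) hv)
  have h2 := (ContinuousMap.evalCLM ℝ s).hasSum h1
  rw [zero_add] at h2
  have hsv : (s : ℝ) • v ∈ Metric.eball (0 : X) r := by
    rw [Metric.mem_eball, edist_zero_right] at hv ⊢
    refine lt_of_le_of_lt ?_ hv
    rw [enorm_smul]
    refine mul_le_of_le_one_left (by simp) ?_
    rw [Real.enorm_of_nonneg s.2.1]
    exact ENNReal.ofReal_le_one.2 s.2.2
  have h3 := hp.hasSum hsv
  refine h2.unique ?_
  convert h3 using 2 with n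
  have h4 := (p n).map_smul_univ (fun _ ↦ (s : ℝ)) (fun _ ↦ v)
  rw [Finset.prod_const, Finset.card_univ, Fintype.card_fin] at h4
  exact h4.symm

/-- The operator 1 - K v is the identity at v = x. Units are open in the Banach algebra of
operators, and inversion is analytic there. -/
lemma AnalyticAt.exists_resolvent {W : Type*} [NormedAddCommGroup W] [NormedSpace ℝ W]
    [CompleteSpace W] {K : X → W →L[ℝ] W} {x : X} (hK : AnalyticAt ℝ K x) (hx : K x = 0) :
    ∃ R : X → W →L[ℝ] W, AnalyticAt ℝ R x ∧ ∀ᶠ v in 𝓝 x, ∀ y, R v (y - K v y) = y := by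
  refine ⟨fun v ↦ Ring.inverse (1 - K v), ?_, ?_⟩
  · have h1 : AnalyticAt ℝ (Ring.inverse : (W →L[ℝ] W) → W →L[ℝ] W) (1 - K x) := by
      rw [hx, sub_zero]
      exact (contDiffAt_ringInverse ℝ (R := W →L[ℝ] W) 1).analyticAt
    exact AnalyticAt.fun_comp h1 (analyticAt_const.sub hK)
  · have hc : ContinuousAt (fun v ↦ 1 - K v) x := continuousAt_const.sub hK.continuousAt
    have hu : ∀ᶠ v in 𝓝 x, IsUnit (1 - K v) :=
      hc.eventually (Units.isOpen.mem_nhds (by simp [hx]))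
    filter_upwards [hu] with v hv y
    calc _ = (Ring.inverse (1 - K v) * (1 - K v)) y := rfl
      _ = y := by rw [Ring.inverse_mul_cancel _ hv]; rfl

/-- When `B v` is the path s ↦ A(x + sv), this is the path s ↦ A(x + sv) v, the coefficient of the
ODE along the ray. -/
lemma AnalyticAt.pathApply_const {H : Type*} [NormedAddCommGroup H] [NormedSpace ℝ H]
    [CompleteSpace H] {B : X → C(unitInterval, X →L[ℝ] H)} {x : X} (hB : AnalyticAt ℝ B x) :
    AnalyticAt ℝ (fun v ↦ pathApply (B v) (ContinuousLinearMap.const (R := ℝ) unitInterval v)) x :=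
  ((((pathApply (X := X) (Y := H)).analyticAt (B x)).fun_comp hB).contDiffAt.clm_apply
    (ContinuousLinearMap.const (R := ℝ) unitInterval).contDiff.contDiffAt).analyticAt

end PathSpace

/-! ### Linear total systems: analyticity -/

namespace LinearTotalSystem

variable {E G : Type*} [NormedAddCommGroup E] [NormedSpace ℝ E] [NormedAddCommGroup G]
  [NormedSpace ℝ G] {A : E → E →L[ℝ] G →L[ℝ] G} {F : E → G} {s : Set E}

lemma _root_.AnalyticAt.pathPrimitive_comp [CompleteSpace G] {N : E → C(unitInterval, G →L[ℝ] G)}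
    {x : E} (hN : AnalyticAt ℝ N x) :
    AnalyticAt ℝ (fun v ↦ (pathPrimitive (X := G)).comp (pathApply (N v))) x :=
  (contDiffAt_const.clm_comp
    (((pathApply (X := G) (Y := G)).analyticAt (N x)).fun_comp hN).contDiffAt).analyticAt

/-- A solution of a real analytic linear total system is real analytic: on the rays at a point it
solves a linear Volterra equation which depends analytically on the direction. -/
theorem analyticAt [CompleteSpace G] {x : E} (hA : AnalyticAt ℝ A x)
    (hF : ∀ᶠ y in 𝓝 x, HasFDerivAt F ((A y).flip (F y)) y) : AnalyticAt ℝ F x := by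
  obtain ⟨B, hB, hBA⟩ := hA.exists_path
  -- The Volterra operator (K v y)(t) = ∫₀ᵗ A(x + sv) v y(s) ds. It vanishes at v = 0 because the
  -- integrand is linear in the constant path v once `B v` is fixed.
  let K : E → C(unitInterval, G) →L[ℝ] C(unitInterval, G) := fun v ↦ pathPrimitive.comp
    (pathApply (pathApply (B v) (ContinuousLinearMap.const (R := ℝ) unitInterval v)))
  have hK : AnalyticAt ℝ K 0 := hB.pathApply_const.pathPrimitive_comp
  have hK0 : K 0 = 0 := by
    ext y t
    simp only [K, map_zero, ContinuousLinearMap.comp_zero]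
  obtain ⟨R, hR, hRK⟩ := hK.exists_resolvent hK0
  have hF' : AnalyticAt ℝ (fun v ↦ F (x + v)) 0 := by
    -- The resolvent applied to the constant path F x recovers s ↦ F(x + sv); its value at time 1 is
    -- F(x + v).
    have h2 : AnalyticAt ℝ (fun v ↦ ContinuousMap.evalCLM ℝ (1 : unitInterval)
        (R v (ContinuousMap.const _ (F x)))) 0 :=
      ((ContinuousMap.evalCLM ℝ (1 : unitInterval)).analyticAt _).fun_comp
        (hR.contDiffAt.clm_apply contDiffAt_const).analyticAt
    refine h2.congr ?_
    obtain ⟨r, hr, hball⟩ := Metric.eventually_nhds_iff_ball.1 hF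
    filter_upwards [hRK, hBA, Metric.ball_mem_nhds (0 : E) hr] with v hu hv hvr
    have hd : ∀ s ∈ Icc (0 : ℝ) 1, HasDerivAt (fun t : ℝ ↦ F (x + t • v))
        (A (x + s • v) v (F (x + s • v))) s := fun s hs ↦ by
      refine hasDerivAt_segment (hball _ ?_)
      rw [mem_ball_iff_norm, add_sub_cancel_left, norm_smul, Real.norm_of_nonneg hs.1]
      exact (mul_le_of_le_one_left (norm_nonneg _) hs.2).trans_lt (by simpa using hvr)
    let y : C(unitInterval, G) := ⟨fun s ↦ F (x + (s : ℝ) • v), by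
      rw [continuous_iff_continuousAt]
      exact fun s ↦ (hd s s.2).continuousAt.comp continuous_subtype_val.continuousAt⟩
    -- The integrated form of the ODE along the ray.
    have hy : y - K v y = ContinuousMap.const _ (F x) := by
      ext t
      have : K v y t = F (x + (t : ℝ) • v) - F x := by
        change pathPrimitive (pathApply (pathApply (B v)
          (ContinuousLinearMap.const (R := ℝ) unitInterval v)) y) t = _
        rw [pathPrimitive_apply, intervalIntegral.integral_eq_sub_of_hasDerivAt
          (f := fun s : ℝ ↦ F (x + s • v)) (fun s hs ↦ ?_)
          (((ContinuousMap.continuous _).Icc_extend' (h := zero_le_one)).intervalIntegrable _ _)]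
        · simp
        · rw [uIcc_of_le t.2.1] at hs
          have hs' : s ∈ Icc (0 : ℝ) 1 := ⟨hs.1, hs.2.trans t.2.2⟩
          rw [IccExtend_of_mem _ _ hs']
          have h3 := hd s hs'
          rwa [← hv ⟨s, hs'⟩] at h3
      change y t - K v y t = _
      rw [this]
      simp [y]
    rw [← hy, hu]
    simp [y]
  have h4 : AnalyticAt ℝ (fun z ↦ z - x) x := analyticAt_id.sub analyticAt_const
  have h5 := AnalyticAt.fun_comp (f := fun z ↦ z - x) (g := fun v ↦ F (x + v)) (x := x)
    (by simpa using hF') h4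
  simpa using h5

end LinearTotalSystem

/-! ### Components in a preferred chart and Christoffel symbols -/

noncomputable section

namespace AffineConnection

variable {m : ℕ} {M : Type*} [TopologicalSpace M] [ChartedSpace (Coord m) M]
  [IsManifold (𝓡 m) ∞ M]

/-- Components of tangent vectors at `y` in the preferred chart at `P`. -/
def coordAt (P y : M) : TangentSpace (𝓡 m) y →L[ℝ] Coord m :=
  (trivializationAt (Coord m) (TangentSpace (𝓡 m)) P).continuousLinearMapAt ℝ y

/-- The tangent vector at `y` with given components in the preferred chart at `P`. -/
def coordSymm (P y : M) : Coord m →L[ℝ] TangentSpace (𝓡 m) y :=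
  (trivializationAt (Coord m) (TangentSpace (𝓡 m)) P).symmL ℝ y

/-- The component function of a vector field in the preferred chart at `P`. -/
def hat (P : M) (X : Π x : M, TangentSpace (𝓡 m) x) : Coord m → Coord m :=
  fun p ↦ coordAt P ((extChartAt (𝓡 m) P).symm p) (X ((extChartAt (𝓡 m) P).symm p))

variable {P y : M}

lemma mem_baseSet_iff : y ∈ (trivializationAt (Coord m) (TangentSpace (𝓡 m)) P).baseSet ↔
    y ∈ (extChartAt (𝓡 m) P).source := by
  rw [extChartAt_source]; rfl

lemma coordAt_coordSymm (hy : y ∈ (extChartAt (𝓡 m) P).source) (w : Coord m) :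
    coordAt P y (coordSymm P y w) = w :=
  Trivialization.continuousLinearMapAt_symmL _ (mem_baseSet_iff.2 hy) w

lemma coordSymm_coordAt (hy : y ∈ (extChartAt (𝓡 m) P).source) (v : TangentSpace (𝓡 m) y) :
    coordSymm P y (coordAt P y v) = v :=
  Trivialization.symmL_continuousLinearMapAt _ (mem_baseSet_iff.2 hy) v

lemma coordAt_injective (hy : y ∈ (extChartAt (𝓡 m) P).source) :
    Function.Injective (coordAt (m := m) P y) :=
  Function.LeftInverse.injective (g := coordSymm P y) (coordSymm_coordAt hy)

lemma coordAt_eq_mfderiv (hy : y ∈ (extChartAt (𝓡 m) P).source) :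
    coordAt P y = mfderiv (𝓡 m) 𝓘(ℝ, Coord m) (extChartAt (𝓡 m) P) y :=
  TangentBundle.continuousLinearMapAt_trivializationAt (by simpa using hy)

lemma coordAt_self (v : TangentSpace (𝓡 m) P) : coordAt P P v = v := by
  rw [coordAt, TangentBundle.continuousLinearMapAt_trivializationAt_eq_core (mem_chart_source _ P)]
  exact (tangentBundleCore (𝓡 m) M).coordChange_self (achart _ P) P (mem_chart_source _ P) v

/-- The coordinate vector field with constant components `w` in the preferred chart at `P`. -/
def frame (P : M) (w : Coord m) : Π y : M, TangentSpace (𝓡 m) y :=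
  fun y ↦ (trivializationAt (Coord m) (TangentSpace (𝓡 m)) P).symm y w

lemma coordSymm_eq_frame (hy : y ∈ (extChartAt (𝓡 m) P).source) (w : Coord m) :
    coordSymm P y w = frame P w y :=
  Trivialization.symmL_apply (R := ℝ) (trivializationAt (Coord m) (TangentSpace (𝓡 m)) P)
    (mem_baseSet_iff.2 hy) w

/-- The extension keeps the components in the trivialization at P constant, and at P itself these
components are w, by `coordAt_self`. -/
lemma constField_eq (w : TangentSpace (𝓡 m) P) : constField w = frame P w := by
  ext1 y
  have h := coordAt_self w
  rw [coordAt, Trivialization.continuousLinearMapAt_apply,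
    Trivialization.linearMapAt_apply, if_pos (mem_baseSet_iff.2 (mem_extChartAt_source P))] at h
  exact congrArg ((trivializationAt (Coord m) (TangentSpace (𝓡 m)) P).symm y) h

lemma coordAt_frame (hy : y ∈ (extChartAt (𝓡 m) P).source) (w : Coord m) :
    coordAt P y (frame P w y) = w := by
  rw [← coordSymm_eq_frame hy, coordAt_coordSymm hy]

lemma isOpen_target (P : M) : IsOpen (extChartAt (𝓡 m) P).target :=
  isOpen_extChartAt_target P

lemma isOpen_target_inter (P : M) {U : Set M} (hU : IsOpen U) :
    IsOpen ((extChartAt (𝓡 m) P).target ∩ (extChartAt (𝓡 m) P).symm ⁻¹' U) :=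
  (continuousOn_extChartAt_symm P).isOpen_inter_preimage (isOpen_target P) hU

lemma hat_extChartAt (hy : y ∈ (extChartAt (𝓡 m) P).source) (X : Π x : M, TangentSpace (𝓡 m) x) :
    hat P X (extChartAt (𝓡 m) P y) = coordAt P y (X y) := by
  rw [hat, PartialEquiv.left_inv _ hy]

lemma hat_frame {p : Coord m} (hp : p ∈ (extChartAt (𝓡 m) P).target)
    (w : Coord m) : hat P (frame P w) p = w :=
  coordAt_frame ((extChartAt (𝓡 m) P).map_target hp) w

lemma mdifferentiableAt_extChartAt_source (hy : y ∈ (extChartAt (𝓡 m) P).source) :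
    MDifferentiableAt (𝓡 m) 𝓘(ℝ, Coord m) (extChartAt (𝓡 m) P) y :=
  mdifferentiableAt_extChartAt (by simpa using hy)

lemma eventually_mem_source (hy : y ∈ (extChartAt (𝓡 m) P).source) :
    ∀ᶠ z in 𝓝 y, z ∈ (extChartAt (𝓡 m) P).source :=
  (isOpen_extChartAt_source P).mem_nhds hy

lemma eventually_mem_target {p : Coord m} (hp : p ∈ (extChartAt (𝓡 m) P).target) :
    ∀ᶠ q in 𝓝 p, q ∈ (extChartAt (𝓡 m) P).target :=
  (isOpen_target P).mem_nhds hp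

lemma section_coord_eventuallyEq (hy : y ∈ (extChartAt (𝓡 m) P).source)
    (X : Π x : M, TangentSpace (𝓡 m) x) :
    (fun x ↦ ((trivializationAt (Coord m) (TangentSpace (𝓡 m)) P) ⟨x, X x⟩).2) =ᶠ[𝓝 y]
      fun x ↦ coordAt P x (X x) := by
  filter_upwards [eventually_mem_source hy] with z hz
  rw [coordAt, Trivialization.continuousLinearMapAt_apply, Trivialization.linearMapAt_apply,
    if_pos (mem_baseSet_iff.2 hz)]

lemma mdifferentiableAt_coordAt (hy : y ∈ (extChartAt (𝓡 m) P).source)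
    {X : Π x : M, TangentSpace (𝓡 m) x}
    (hX : MDifferentiableAt (𝓡 m) ((𝓡 m).prod (𝓡 m)) (fun x ↦ (X x : TangentBundle (𝓡 m) M)) y) :
    MDifferentiableAt (𝓡 m) 𝓘(ℝ, Coord m) (fun x ↦ coordAt P x (X x)) y :=
  (((trivializationAt (Coord m) (TangentSpace (𝓡 m)) P).mdifferentiableAt_section_iff
    (𝓡 m) X (mem_baseSet_iff.2 hy)).1 hX).congr_of_eventuallyEq
      (section_coord_eventuallyEq hy X).symm

lemma contMDiffAt_section_iff_coordAt {n : ℕ∞ω}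
    [ContMDiffVectorBundle n (Coord m) (TangentSpace (𝓡 m) : M → Type _) (𝓡 m)]
    (hy : y ∈ (extChartAt (𝓡 m) P).source) {X : Π x : M, TangentSpace (𝓡 m) x} :
    ContMDiffAt (𝓡 m) ((𝓡 m).prod (𝓡 m)) n (fun x ↦ (X x : TangentBundle (𝓡 m) M)) y ↔
    ContMDiffAt (𝓡 m) 𝓘(ℝ, Coord m) n (fun x ↦ coordAt P x (X x)) y := by
  rw [(trivializationAt (Coord m) (TangentSpace (𝓡 m)) P).contMDiffAt_section_iff
    (mem_baseSet_iff.2 hy)]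
  exact (section_coord_eventuallyEq hy X).contMDiffAt_iff

lemma differentiableAt_comp_symm {F : Type*} [NormedAddCommGroup F] [NormedSpace ℝ F]
    (hy : y ∈ (extChartAt (𝓡 m) P).source) {f : M → F}
    (hf : MDifferentiableAt (𝓡 m) 𝓘(ℝ, F) f y) :
    DifferentiableAt ℝ (f ∘ (extChartAt (𝓡 m) P).symm) (extChartAt (𝓡 m) P y) := by
  rw [← mdifferentiableAt_iff_differentiableAt]
  have hp := (extChartAt (𝓡 m) P).map_source hy
  refine MDifferentiableAt.comp _ (by rwa [PartialEquiv.left_inv _ hy]) ?_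
  exact ((contMDiffOn_extChartAt_symm (n := 1) P).contMDiffAt
    ((isOpen_target P).mem_nhds hp)).mdifferentiableAt one_ne_zero

lemma contDiffAt_comp_symm_iff {F : Type*} [NormedAddCommGroup F] [NormedSpace ℝ F] {n : ℕ∞ω}
    [IsManifold (𝓡 m) n M] (hy : y ∈ (extChartAt (𝓡 m) P).source) {f : M → F} :
    ContMDiffAt (𝓡 m) 𝓘(ℝ, F) n f y ↔
    ContDiffAt ℝ n (f ∘ (extChartAt (𝓡 m) P).symm) (extChartAt (𝓡 m) P y) := by
  have hp := (extChartAt (𝓡 m) P).map_source hy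
  rw [← contMDiffAt_iff_contDiffAt]
  constructor
  · intro hf
    refine ContMDiffAt.comp _ (by rwa [PartialEquiv.left_inv _ hy]) ?_
    exact (contMDiffOn_extChartAt_symm P).contMDiffAt ((isOpen_target P).mem_nhds hp)
  · intro hf
    refine (hf.comp y (contMDiffAt_extChartAt' (by simpa using hy))).congr_of_eventuallyEq ?_
    filter_upwards [eventually_mem_source hy] with z hz
    simp only [Function.comp_apply, PartialEquiv.left_inv _ hz]

lemma mvfderiv_eq (hy : y ∈ (extChartAt (𝓡 m) P).source) {f : M → ℝ}
    (hf : MDifferentiableAt (𝓡 m) 𝓘(ℝ, ℝ) f y) (v : TangentSpace (𝓡 m) y) :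
    mvfderiv (𝓡 m) f y v = fderiv ℝ (f ∘ (extChartAt (𝓡 m) P).symm) (extChartAt (𝓡 m) P y)
      (coordAt P y v) := by
  have hd := differentiableAt_comp_symm hy hf
  have he : f =ᶠ[𝓝 y] (f ∘ (extChartAt (𝓡 m) P).symm) ∘ extChartAt (𝓡 m) P := by
    filter_upwards [eventually_mem_source hy] with z hz
    simp only [Function.comp_apply, PartialEquiv.left_inv _ hz]
  rw [mvfderiv_congr he, mvfderiv_comp_apply y hd.mdifferentiableAt
    (mdifferentiableAt_extChartAt_source hy), coordAt_eq_mfderiv hy]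
  change (mfderiv 𝓘(ℝ, Coord m) 𝓘(ℝ, ℝ) _ _ : Coord m →L[ℝ] ℝ) _ = _
  rw [mfderiv_eq_fderiv]
  rfl

lemma hat_eq_comp (X : Π x : M, TangentSpace (𝓡 m) x) :
    hat P X = (fun x ↦ coordAt P x (X x)) ∘ (extChartAt (𝓡 m) P).symm := rfl

lemma differentiableAt_hat (hy : y ∈ (extChartAt (𝓡 m) P).source)
    {X : Π x : M, TangentSpace (𝓡 m) x}
    (hX : MDifferentiableAt (𝓡 m) ((𝓡 m).prod (𝓡 m)) (fun x ↦ (X x : TangentBundle (𝓡 m) M)) y) :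
    DifferentiableAt ℝ (hat P X) (extChartAt (𝓡 m) P y) :=
  differentiableAt_comp_symm hy (mdifferentiableAt_coordAt hy hX)

lemma contMDiffAt_section_iff_hat {n : ℕ∞ω} [IsManifold (𝓡 m) n M]
    [ContMDiffVectorBundle n (Coord m) (TangentSpace (𝓡 m) : M → Type _) (𝓡 m)]
    (hy : y ∈ (extChartAt (𝓡 m) P).source) {X : Π x : M, TangentSpace (𝓡 m) x} :
    ContMDiffAt (𝓡 m) ((𝓡 m).prod (𝓡 m)) n (fun x ↦ (X x : TangentBundle (𝓡 m) M)) y ↔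
    ContDiffAt ℝ n (hat P X) (extChartAt (𝓡 m) P y) := by
  rw [contMDiffAt_section_iff_coordAt hy, contDiffAt_comp_symm_iff hy, hat_eq_comp]

lemma contMDiffAt_frame {n : ℕ∞ω} [IsManifold (𝓡 m) n M]
    [ContMDiffVectorBundle n (Coord m) (TangentSpace (𝓡 m) : M → Type _) (𝓡 m)]
    (hy : y ∈ (extChartAt (𝓡 m) P).source) (w : Coord m) :
    ContMDiffAt (𝓡 m) ((𝓡 m).prod (𝓡 m)) n
      (fun x ↦ (frame P w x : TangentBundle (𝓡 m) M)) y := by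
  rw [contMDiffAt_section_iff_hat hy]
  refine (contDiffAt_const (c := w)).congr_of_eventuallyEq ?_
  filter_upwards [eventually_mem_target ((extChartAt (𝓡 m) P).map_source hy)] with q hq
  exact hat_frame hq w

lemma mdifferentiableAt_frame (hy : y ∈ (extChartAt (𝓡 m) P).source) (w : Coord m) :
    MDifferentiableAt (𝓡 m) ((𝓡 m).prod (𝓡 m))
      (fun x ↦ (frame P w x : TangentBundle (𝓡 m) M)) y :=
  (contMDiffAt_frame (n := ∞) hy w).mdifferentiableAt (by simp)

/-- The Christoffel symbols in the preferred chart at `P`: `christoffel D P p w u` consists of the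
components of `∇_u W`, where `W` has constant components `w`. -/
def christoffel (D : AffineConnection m M) (P : M) (p : Coord m) :
    Coord m →L[ℝ] Coord m →L[ℝ] Coord m :=
  ∑ i, (EuclideanSpace.proj i : Coord m →L[ℝ] ℝ).smulRight
    (ContinuousLinearMap.inCoordinates (Coord m) (TangentSpace (𝓡 m)) (Coord m)
      (TangentSpace (𝓡 m)) P ((extChartAt (𝓡 m) P).symm p) P ((extChartAt (𝓡 m) P).symm p)
      (D.toFun (frame P (EuclideanSpace.single i 1)) ((extChartAt (𝓡 m) P).symm p)))

lemma christoffel_apply (D : AffineConnection m M) (p w u : Coord m) :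
    christoffel D P p w u = ∑ i, w i • coordAt P ((extChartAt (𝓡 m) P).symm p)
      (D.toFun (frame P (EuclideanSpace.single i 1)) ((extChartAt (𝓡 m) P).symm p)
        (coordSymm P ((extChartAt (𝓡 m) P).symm p) u)) := by
  simp only [christoffel, sum_apply]
  rfl

lemma toFun_sum (D : AffineConnection m M) {ι : Type*} (s : Finset ι)
    (Y : ι → Π x : M, TangentSpace (𝓡 m) x) (hY : ∀ i ∈ s, MDifferentiableAt (𝓡 m)
      ((𝓡 m).prod (𝓡 m)) (fun x ↦ (Y i x : TangentBundle (𝓡 m) M)) y) :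
    D.toFun (fun x ↦ ∑ i ∈ s, Y i x) y = ∑ i ∈ s, D.toFun (Y i) y := by
  classical
  induction s using Finset.induction_on with
  | empty =>
    simp only [Finset.sum_empty]
    exact congrFun D.toCovariantDerivative.zero y
  | insert a s ha ih =>
    simp only [Finset.sum_insert ha]
    rw [← ih fun i hi ↦ hY i (Finset.mem_insert_of_mem hi)]
    exact D.isCovariantDerivativeOnUniv.add (hY a (Finset.mem_insert_self a s))
      (.sum_section fun i hi ↦ hY i (Finset.mem_insert_of_mem hi))

lemma eq_sum_frame (hy : y ∈ (extChartAt (𝓡 m) P).source) (Y : Π x : M, TangentSpace (𝓡 m) x) :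
    Y y = ∑ i, (coordAt P y (Y y)) i • frame P (EuclideanSpace.single i 1) y := by
  conv_lhs => rw [← coordSymm_coordAt hy (Y y)]
  have h : ∀ w : Coord m, w = ∑ i, w i • EuclideanSpace.single i (1 : ℝ) := fun w ↦ by
    ext j
    simp [Finset.sum_apply, Pi.single_apply]
  conv_lhs => rw [h (coordAt P y (Y y))]
  simp only [map_sum, map_smul]
  simp only [coordSymm_eq_frame hy]

/-- The coordinate expression of a covariant derivative. -/
theorem coordAt_toFun (D : AffineConnection m M) (hy : y ∈ (extChartAt (𝓡 m) P).source)
    {Y : Π x : M, TangentSpace (𝓡 m) x}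
    (hY : MDifferentiableAt (𝓡 m) ((𝓡 m).prod (𝓡 m)) (fun x ↦ (Y x : TangentBundle (𝓡 m) M)) y)
    (v : TangentSpace (𝓡 m) y) :
    coordAt P y (D.toFun Y y v) =
      fderiv ℝ (hat P Y) (extChartAt (𝓡 m) P y) (coordAt P y v) +
        christoffel D P (extChartAt (𝓡 m) P y) (coordAt P y (Y y)) (coordAt P y v) := by
  let e (i : Fin m) : Coord m := EuclideanSpace.single i 1
  let a (i : Fin m) : M → ℝ := fun x ↦ coordAt P x (Y x) i
  have ha (i) : MDifferentiableAt (𝓡 m) 𝓘(ℝ, ℝ) (a i) y :=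
    ((EuclideanSpace.proj i : Coord m →L[ℝ] ℝ).mdifferentiableAt).comp y
      (mdifferentiableAt_coordAt hy hY)
  have hae (i) : MDifferentiableAt (𝓡 m) ((𝓡 m).prod (𝓡 m))
      (fun x ↦ ((a i • frame P (e i)) x : TangentBundle (𝓡 m) M)) y :=
    MDifferentiableAt.smul_section (ha i) (mdifferentiableAt_frame hy (e i))
  have hsum : MDifferentiableAt (𝓡 m) ((𝓡 m).prod (𝓡 m))
      (fun x ↦ ((∑ i, (a i • frame P (e i)) x : TangentSpace (𝓡 m) x) : TangentBundle (𝓡 m) M)) y :=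
    .sum_section fun i _ ↦ hae i
  -- The frame expansion of Y holds only on the chart domain; locality of the covariant derivative
  -- allows the replacement. The Leibniz rule then splits each summand into the derivative of a
  -- component and a Christoffel term.
  have h1 : D.toFun Y y = D.toFun (fun x ↦ ∑ i, (a i • frame P (e i)) x) y :=
    D.isCovariantDerivativeOnUniv.congr_of_eventuallyEq hY hsum univ_mem (by
      filter_upwards [eventually_mem_source hy] with z hz
      exact eq_sum_frame hz Y)
  have h2 (i) : D.toFun (a i • frame P (e i)) y =
      a i y • D.toFun (frame P (e i)) y + (mvfderiv (𝓡 m) (a i) y).smulRight (frame P (e i) y) :=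
    D.isCovariantDerivativeOnUniv.leibniz (mdifferentiableAt_frame hy (e i)) (ha i)
  have h3 (i) : mvfderiv (𝓡 m) (a i) y v =
      (fderiv ℝ (hat P Y) (extChartAt (𝓡 m) P y) (coordAt P y v)) i := by
    rw [mvfderiv_eq hy (ha i)]
    have := ((EuclideanSpace.proj i : Coord m →L[ℝ] ℝ).hasFDerivAt.comp _
      (differentiableAt_hat hy hY).hasFDerivAt).fderiv
    exact congrArg (fun L : Coord m →L[ℝ] ℝ ↦ L (coordAt P y v)) this
  rw [h1, toFun_sum D _ _ fun i _ ↦ hae i, christoffel_apply, PartialEquiv.left_inv _ hy,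
    coordSymm_coordAt hy]
  have h4 (i) : coordAt P y (D.toFun (a i • frame P (e i)) y v) =
      (fderiv ℝ (hat P Y) (extChartAt (𝓡 m) P y) (coordAt P y v)) i • e i +
        a i y • coordAt P y (D.toFun (frame P (e i)) y v) := by
    rw [h2, ← h3]
    change coordAt P y (a i y • D.toFun (frame P (e i)) y v +
      mvfderiv (𝓡 m) (a i) y v • frame P (e i) y) = _
    rw [map_add, map_smul, map_smul, coordAt_frame hy, add_comm]
  rw [sum_apply, map_sum, Finset.sum_congr rfl fun i _ ↦ h4 i, Finset.sum_add_distrib]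
  congr 1
  ext j
  simp [e, Pi.single_apply]

end AffineConnection

end

/-! ### Connections on a vector space: curvature, Ricci tensor and Killing fields -/

namespace FlatConnection

variable {E : Type*} [NormedAddCommGroup E] [NormedSpace ℝ E]

/-- The covariant derivative `∇_X Y` of a connection on a vector space with Christoffel symbols
`Γ`, where `Γ p w u` stands for `∇_u w` with `w` constant. -/
noncomputable def nabla (Γ : E → E →L[ℝ] E →L[ℝ] E) (X Y : E → E) (p : E) : E :=
  fderiv ℝ Y p (X p) + Γ p (Y p) (X p)

/-- The curvature `R(u, v) w` in terms of the Christoffel symbols. -/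
noncomputable def curvature (Γ : E → E →L[ℝ] E →L[ℝ] E) (p u v w : E) : E :=
  fderiv ℝ Γ p u w v - fderiv ℝ Γ p v w u + Γ p (Γ p w v) u - Γ p (Γ p w u) v

/-- Identities between higher derivatives are obtained below by restricting both sides to a line,
applying one-variable product rules and invoking uniqueness of the derivative. -/
lemma hasDerivAt_line {F : Type*} [NormedAddCommGroup F] [NormedSpace ℝ F] {f : E → F} {p : E}
    (hf : DifferentiableAt ℝ f p) (u : E) :
    HasDerivAt (fun t : ℝ ↦ f (p + t • u)) (fderiv ℝ f p u) 0 := by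
  have h : HasDerivAt (fun t : ℝ ↦ p + t • u) u 0 := by
    simpa using ((hasDerivAt_id (0 : ℝ)).smul_const u).const_add p
  have hf' : HasFDerivAt f (fderiv ℝ f p) (p + (0 : ℝ) • u) := by simpa using hf.hasFDerivAt
  exact hf'.comp_hasDerivAt 0 h

lemma eventually_line {p : E} {Q : E → Prop} (h : ∀ᶠ q in 𝓝 p, Q q) (u : E) :
    ∀ᶠ t : ℝ in 𝓝 0, Q (p + t • u) := by
  have hc : Tendsto (fun t : ℝ ↦ p + t • u) (𝓝 0) (𝓝 p) := by
    have : Continuous fun t : ℝ ↦ p + t • u := by fun_prop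
    simpa using this.tendsto 0
  exact hc.eventually h

lemma _root_.ContDiffAt.fderiv_swap {F : Type*} [NormedAddCommGroup F] [NormedSpace ℝ F]
    {f : E → F} {p : E}
    (hf : ContDiffAt ℝ 2 f p) (u v : E) :
    fderiv ℝ (fderiv ℝ f) p u v = fderiv ℝ (fderiv ℝ f) p v u :=
  hf.isSymmSndFDerivAt (by simp) u v

lemma _root_.ContDiffAt.differentiableAt_fderiv {F : Type*} [NormedAddCommGroup F] [NormedSpace ℝ F]
    {f : E → F} {p : E} (hf : ContDiffAt ℝ 2 f p) : DifferentiableAt ℝ (fderiv ℝ f) p :=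
  (hf.fderiv_right (m := 1) (by norm_num)).differentiableAt one_ne_zero

variable {Γ : E → E →L[ℝ] E →L[ℝ] E} {X Y Z : E → E} {p : E}

lemma fderiv_nabla (hΓ : ContDiffAt ℝ 1 Γ p) (hX : ContDiffAt ℝ 1 X p) (hY : ContDiffAt ℝ 2 Y p)
    (u : E) : fderiv ℝ (nabla Γ X Y) p u =
      fderiv ℝ (fderiv ℝ Y) p u (X p) + fderiv ℝ Y p (fderiv ℝ X p u) +
        (fderiv ℝ Γ p u (Y p) (X p) + Γ p (fderiv ℝ Y p u) (X p) + Γ p (Y p) (fderiv ℝ X p u)) := by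
  have dΓ := hasDerivAt_line (F := E →L[ℝ] E →L[ℝ] E) (hΓ.differentiableAt one_ne_zero) u
  have dX := hasDerivAt_line (hX.differentiableAt one_ne_zero) u
  have dY := hasDerivAt_line (hY.differentiableAt two_ne_zero) u
  have dY' := hasDerivAt_line hY.differentiableAt_fderiv u
  have hd : DifferentiableAt ℝ (nabla Γ X Y) p :=
    (hY.differentiableAt_fderiv.clm_apply (hX.differentiableAt one_ne_zero)).add
      (((hΓ.differentiableAt one_ne_zero).clm_apply (hY.differentiableAt two_ne_zero)).clm_apply
        (hX.differentiableAt one_ne_zero))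
  have h := (hasDerivAt_line hd u).unique
    ((dY'.clm_apply dX).add ((dΓ.clm_apply dY).clm_apply dX))
  simpa using h

/-- The curvature operator of a connection on a vector space is tensorial. -/
theorem curvature_eq (hΓ : ContDiffAt ℝ 1 Γ p) (hX : ContDiffAt ℝ 1 X p) (hY : ContDiffAt ℝ 1 Y p)
    (hZ : ContDiffAt ℝ 2 Z p) :
    nabla Γ X (nabla Γ Y Z) p - nabla Γ Y (nabla Γ X Z) p - nabla Γ (lieBracket ℝ X Y) Z p =
      curvature Γ p (X p) (Y p) (Z p) := by
  rw [nabla, nabla, nabla, fderiv_nabla hΓ hY hZ, fderiv_nabla hΓ hX hZ]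
  -- The second derivatives of Z cancel by symmetry, and the first derivatives of X and Y cancel
  -- against the bracket term.
  simp only [nabla, lieBracket, map_sub, map_add, add_apply, curvature,
    hZ.fderiv_swap (X p) (Y p)]
  abel

/-- The coordinate form of the equation `L_X ∇ = 0`. -/
def IsKillingAt (Γ : E → E →L[ℝ] E →L[ℝ] E) (X : E → E) (p : E) : Prop :=
  ∀ v w, fderiv ℝ Γ p (X p) w v = fderiv ℝ X p (Γ p w v) - Γ p w (fderiv ℝ X p v) -
    Γ p (fderiv ℝ X p w) v - fderiv ℝ (fderiv ℝ X) p v w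

/-- The curvature of a connection is invariant under affine Killing fields. -/
theorem IsKillingAt.fderiv_curvature (hΓ : ContDiffAt ℝ 2 Γ p) (hX : ContDiffAt ℝ 3 X p)
    (hK : ∀ᶠ q in 𝓝 p, IsKillingAt Γ X q) (u v w : E) :
    fderiv ℝ (fun q ↦ curvature Γ q u v w) p (X p) =
      fderiv ℝ X p (curvature Γ p u v w) - curvature Γ p (fderiv ℝ X p u) v w -
        curvature Γ p u (fderiv ℝ X p v) w - curvature Γ p u v (fderiv ℝ X p w) := by
  have hΓd := hΓ.differentiableAt two_ne_zero
  have hΓ' := hΓ.differentiableAt_fderiv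
  have hX2 : ContDiffAt ℝ 2 X p := hX.of_le (by norm_num)
  have hX' : ContDiffAt ℝ 2 (fderiv ℝ X) p := hX.fderiv_right (by norm_num)
  -- The Killing equation differentiated in the direction u.
  have hKd : ∀ u v w, fderiv ℝ (fderiv ℝ Γ) p u (X p) w v + fderiv ℝ Γ p (fderiv ℝ X p u) w v =
      fderiv ℝ (fderiv ℝ X) p u (Γ p w v) + fderiv ℝ X p (fderiv ℝ Γ p u w v) -
        (fderiv ℝ Γ p u w (fderiv ℝ X p v) + Γ p w (fderiv ℝ (fderiv ℝ X) p u v)) -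
        (fderiv ℝ Γ p u (fderiv ℝ X p w) v + Γ p (fderiv ℝ (fderiv ℝ X) p u w) v) -
        fderiv ℝ (fderiv ℝ (fderiv ℝ X)) p u v w := by
    intro u v w
    have dΓ := hasDerivAt_line (F := E →L[ℝ] E →L[ℝ] E) hΓd u
    have dΓ' := hasDerivAt_line (F := E →L[ℝ] E →L[ℝ] E →L[ℝ] E) hΓ' u
    have dX := hasDerivAt_line (hX2.differentiableAt two_ne_zero) u
    have dX' := hasDerivAt_line (hX'.differentiableAt two_ne_zero) u
    have dX'' := hasDerivAt_line (F := E →L[ℝ] E →L[ℝ] E) hX'.differentiableAt_fderiv u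
    have cst (a : E) := hasDerivAt_const (0 : ℝ) a
    have hl := ((dΓ'.clm_apply dX).clm_apply (cst w)).clm_apply (cst v)
    have hr := (((dX'.clm_apply ((dΓ.clm_apply (cst w)).clm_apply (cst v))).sub
      ((dΓ.clm_apply (cst w)).clm_apply (dX'.clm_apply (cst v)))).sub
      ((dΓ.clm_apply (dX'.clm_apply (cst w))).clm_apply (cst v))).sub
      ((dX''.clm_apply (cst v)).clm_apply (cst w))
    have he := hl.unique (hr.congr_of_eventuallyEq
      ((eventually_line hK u).mono fun t ht ↦ ht v w))
    simpa using he
  have hd : DifferentiableAt ℝ (fun q ↦ curvature Γ q u v w) p := by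
    unfold curvature
    have c (a : E) : DifferentiableAt ℝ (fun _ : E ↦ a) p := differentiableAt_const a
    exact (((((hΓ'.clm_apply (c u)).clm_apply (c w)).clm_apply (c v)).sub
      (((hΓ'.clm_apply (c v)).clm_apply (c w)).clm_apply (c u))).add
      ((hΓd.clm_apply ((hΓd.clm_apply (c w)).clm_apply (c v))).clm_apply (c u))).sub
      ((hΓd.clm_apply ((hΓd.clm_apply (c w)).clm_apply (c u))).clm_apply (c v))
  have dΓ := hasDerivAt_line (F := E →L[ℝ] E →L[ℝ] E) hΓd (X p)
  have dΓ' := hasDerivAt_line (F := E →L[ℝ] E →L[ℝ] E →L[ℝ] E) hΓ' (X p)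
  have cst (a : E) := hasDerivAt_const (0 : ℝ) a
  have h := (hasDerivAt_line hd (X p)).unique
    ((((((dΓ'.clm_apply (cst u)).clm_apply (cst w)).clm_apply (cst v)).sub
      (((dΓ'.clm_apply (cst v)).clm_apply (cst w)).clm_apply (cst u))).add
      ((dΓ.clm_apply ((dΓ.clm_apply (cst w)).clm_apply (cst v))).clm_apply (cst u))).sub
      ((dΓ.clm_apply ((dΓ.clm_apply (cst w)).clm_apply (cst u))).clm_apply (cst v)))
  rw [h]
  -- Antisymmetrizing in u and v removes the third derivatives of X. The symmetry of the second
  -- derivatives of Γ moves X p into the first slot, as in the derivative of the curvature along X.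
  have h1 := hKd u v w
  have h2 := hKd v u w
  rw [hX'.fderiv_swap v u, hX2.fderiv_swap v u] at h2
  rw [← hΓ.fderiv_swap] at h1 h2
  have hKp := hK.self_of_nhds
  have hK' (a b : E) := hKp a b
  simp only [zero_smul, add_zero, map_zero, add_apply, hK', curvature, map_sub, map_add,
    sub_apply]
  linear_combination (norm := module) h1 - h2

/-- The curvature is linear in its first argument. -/
noncomputable def curvatureLin (Γ : E → E →L[ℝ] E →L[ℝ] E) (p v w : E) : E →ₗ[ℝ] E where
  toFun u := curvature Γ p u v w
  map_add' a b := by simp only [curvature, map_add, add_apply]; abel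
  map_smul' c a := by
    simp only [curvature, map_smul, smul_apply, RingHom.id_apply]; module

/-- The trace is cyclic. This gives both the invariance of the Ricci contraction under a change of
basis and its behaviour under Killing fields. -/
lemma sum_coord_eq_trace {m : ℕ} (T : Coord m →ₗ[ℝ] Coord m) :
    ∑ i, T (EuclideanSpace.single i 1) i = LinearMap.trace ℝ _ T := by
  rw [LinearMap.trace_eq_matrix_trace ℝ (EuclideanSpace.basisFun (Fin m) ℝ).toBasis, Matrix.trace]
  simp [LinearMap.toMatrix_apply]

variable {m : ℕ} {Γ : Coord m → Coord m →L[ℝ] Coord m →L[ℝ] Coord m} {p : Coord m}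
  {X : Coord m → Coord m}

/-- The Ricci tensor in terms of the Christoffel symbols. -/
noncomputable def ricci (Γ : Coord m → Coord m →L[ℝ] Coord m →L[ℝ] Coord m) (p v w : Coord m) : ℝ :=
  ∑ i, curvature Γ p (EuclideanSpace.single i 1) v w i

lemma ricci_eq_trace (v w : Coord m) :
    ricci Γ p v w = LinearMap.trace ℝ _ (curvatureLin Γ p v w) :=
  sum_coord_eq_trace (curvatureLin Γ p v w)

/-- The condition n + 1 ≤ n singles out ∞ and ω, for which taking a derivative of Γ costs no
regularity. -/
lemma contDiffOn_curvature {E : Type*} [NormedAddCommGroup E] [NormedSpace ℝ E]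
    {Γ : E → E →L[ℝ] E →L[ℝ] E} {s : Set E} {n : ℕ∞ω} (hs : IsOpen s)
    (hn : n + 1 ≤ n) (hΓ : ContDiffOn ℝ n Γ s) (u v w : E) :
    ContDiffOn ℝ n (fun q ↦ curvature Γ q u v w) s := by
  have hΓ' := hΓ.fderiv_of_isOpen hs hn
  have c (a : E) : ContDiffOn ℝ n (fun _ : E ↦ a) s := contDiffOn_const
  exact (((((hΓ'.clm_apply (c u)).clm_apply (c w)).clm_apply (c v)).sub
    (((hΓ'.clm_apply (c v)).clm_apply (c w)).clm_apply (c u))).add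
    ((hΓ.clm_apply ((hΓ.clm_apply (c w)).clm_apply (c v))).clm_apply (c u))).sub
    ((hΓ.clm_apply ((hΓ.clm_apply (c w)).clm_apply (c u))).clm_apply (c v))

/-- The Ricci tensor is invariant under affine Killing fields. -/
theorem IsKillingAt.fderiv_ricci {s : Set (Coord m)} (hs : IsOpen s) (hp : p ∈ s)
    (hΓ : ContDiffOn ℝ ∞ Γ s) (hX : ContDiffOn ℝ ∞ X s)
    (hK : ∀ q ∈ s, IsKillingAt Γ X q) (v w : Coord m) :
    fderiv ℝ (fun q ↦ ricci Γ q v w) p (X p) =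
      - ricci Γ p (fderiv ℝ X p v) w - ricci Γ p v (fderiv ℝ X p w) := by
  have hsp := hs.mem_nhds hp
  let e (i : Fin m) : Coord m := EuclideanSpace.single i 1
  have hd (i) : DifferentiableAt ℝ (fun q ↦ curvature Γ q (e i) v w) p :=
    ((contDiffOn_curvature hs (by simp) hΓ (e i) v w).contDiffAt hsp).differentiableAt (by simp)
  have h1 : fderiv ℝ (fun q ↦ ricci Γ q v w) p (X p) =
      ∑ i, fderiv ℝ (fun q ↦ curvature Γ q (e i) v w) p (X p) i := by
    have h2 : HasFDerivAt (fun q ↦ ricci Γ q v w)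
        (∑ i, (EuclideanSpace.proj i : Coord m →L[ℝ] ℝ).comp
          (fderiv ℝ (fun q ↦ curvature Γ q (e i) v w) p)) p :=
      HasFDerivAt.fun_sum fun i _ ↦
        (EuclideanSpace.proj i : Coord m →L[ℝ] ℝ).hasFDerivAt.comp p (hd i).hasFDerivAt
    rw [h2.fderiv, sum_apply]
    rfl
  have h3 (i) := IsKillingAt.fderiv_curvature ((hΓ.contDiffAt hsp).of_le ENat.LEInfty.out)
    ((hX.contDiffAt hsp).of_le ENat.LEInfty.out)
    (Filter.mem_of_superset hsp hK) (e i) v w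
  -- By cyclicity of the trace, the derivative of X acting on the output of the curvature cancels
  -- against the one acting on the contracted argument.
  have h4 : ∑ i, fderiv ℝ X p (curvature Γ p (e i) v w) i =
      ∑ i, curvature Γ p (fderiv ℝ X p (e i)) v w i := by
    have := LinearMap.trace_mul_comm ℝ (fderiv ℝ X p : Coord m →ₗ[ℝ] Coord m) (curvatureLin Γ p v w)
    rwa [← sum_coord_eq_trace, ← sum_coord_eq_trace] at this
  rw [h1, ricci, ricci]
  simp only [h3, PiLp.sub_apply, Finset.sum_sub_distrib, h4]
  ring

/-- The Ricci tensor as a continuous bilinear form. -/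
noncomputable def ricciSymm (Γ : Coord m → Coord m →L[ℝ] Coord m →L[ℝ] Coord m) (p : Coord m) :
    Coord m →L[ℝ] Coord m →L[ℝ] ℝ :=
  LinearMap.toContinuousLinearMap <| LinearMap.toContinuousLinearMap.toLinearMap ∘ₗ
    LinearMap.mk₂ ℝ (fun v w ↦ 1 / 2 * (ricci Γ p v w + ricci Γ p w v))
      (fun a b w ↦ by
        simp only [ricci, curvature, map_add, add_apply, PiLp.add_apply, PiLp.sub_apply,
          Finset.sum_add_distrib, Finset.sum_sub_distrib]; ring)
      (fun c b w ↦ by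
        simp only [ricci, curvature, map_smul, smul_apply, PiLp.add_apply, PiLp.sub_apply,
          PiLp.smul_apply, Finset.sum_add_distrib, Finset.sum_sub_distrib,
          smul_eq_mul, ← Finset.mul_sum]; ring)
      (fun a b w ↦ by
        simp only [ricci, curvature, map_add, add_apply, PiLp.add_apply, PiLp.sub_apply,
          Finset.sum_add_distrib, Finset.sum_sub_distrib]; ring)
      (fun c b w ↦ by
        simp only [ricci, curvature, map_smul, smul_apply, PiLp.add_apply, PiLp.sub_apply,
          PiLp.smul_apply, Finset.sum_add_distrib, Finset.sum_sub_distrib,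
          smul_eq_mul, ← Finset.mul_sum]; ring)

lemma ricciSymm_apply (v w : Coord m) :
    ricciSymm Γ p v w = 1 / 2 * (ricci Γ p v w + ricci Γ p w v) := rfl

lemma contDiffOn_ricci {s : Set (Coord m)} {n : ℕ∞ω} (hs : IsOpen s)
    (hn : n + 1 ≤ n) (hΓ : ContDiffOn ℝ n Γ s) (v w : Coord m) :
    ContDiffOn ℝ n (fun q ↦ ricci Γ q v w) s :=
  ContDiffOn.sum fun i _ ↦ (EuclideanSpace.proj i : Coord m →L[ℝ] ℝ).contDiff.comp_contDiffOn
    (contDiffOn_curvature hs hn hΓ _ v w)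

lemma contDiffOn_ricciSymm {s : Set (Coord m)} {n : ℕ∞ω} (hs : IsOpen s)
    (hn : n + 1 ≤ n) (hΓ : ContDiffOn ℝ n Γ s) : ContDiffOn ℝ n (ricciSymm Γ) s := by
  rw [contDiffOn_clm_apply]
  intro v
  rw [contDiffOn_clm_apply]
  intro w
  exact contDiffOn_const.mul
    ((contDiffOn_ricci hs hn hΓ v w).add (contDiffOn_ricci hs hn hΓ w v))

/-- The coefficients of the linear total system for the 1-jet `(f, df)` of a function satisfying
`∇ df = μ f ρ_s`. -/
noncomputable def jetCoeff (μ : ℝ) (Γ : Coord m → Coord m →L[ℝ] Coord m →L[ℝ] Coord m)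
    (p : Coord m) :
    Coord m →L[ℝ] (ℝ × (Coord m →L[ℝ] ℝ)) →L[ℝ] (ℝ × (Coord m →L[ℝ] ℝ)) :=
  LinearMap.toContinuousLinearMap <| LinearMap.toContinuousLinearMap.toLinearMap ∘ₗ
    LinearMap.mk₂ ℝ (fun (u : Coord m) (z : ℝ × (Coord m →L[ℝ] ℝ)) ↦
        (z.2 u, z.2.comp ((Γ p).flip u) + (μ * z.1) • ricciSymm Γ p u))
      (fun a b w ↦ by ext <;> simp; ring)
      (fun c b w ↦ by ext <;> simp; ring)
      (fun a b w ↦ by ext <;> simp; ring)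
      (fun c b w ↦ by ext <;> simp; ring)

lemma jetCoeff_apply (μ : ℝ) (u : Coord m) (z : ℝ × (Coord m →L[ℝ] ℝ)) :
    jetCoeff μ Γ p u z = (z.2 u, z.2.comp ((Γ p).flip u) + (μ * z.1) • ricciSymm Γ p u) := rfl

lemma contDiffOn_jetCoeff (μ : ℝ) {s : Set (Coord m)} {n : ℕ∞ω} (hs : IsOpen s)
    (hn : n + 1 ≤ n) (hΓ : ContDiffOn ℝ n Γ s) : ContDiffOn ℝ n (jetCoeff μ Γ) s := by
  rw [contDiffOn_clm_apply]
  intro u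
  rw [contDiffOn_clm_apply]
  intro z
  simp only [jetCoeff_apply]
  refine contDiffOn_const.prodMk (ContDiffOn.add ?_ (ContDiffOn.const_smul _
    ((contDiffOn_ricciSymm hs hn hΓ).clm_apply contDiffOn_const)))
  rw [contDiffOn_clm_apply]
  intro w
  exact z.2.contDiff.comp_contDiffOn
    ((hΓ.clm_apply contDiffOn_const).clm_apply contDiffOn_const)

/-- The quasi-Einstein equation at `p` in coordinates. -/
def IsSolutionAt (μ : ℝ) (Γ : Coord m → Coord m →L[ℝ] Coord m →L[ℝ] Coord m) (f : Coord m → ℝ)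
    (p : Coord m) : Prop :=
  ∀ v w, fderiv ℝ (fderiv ℝ f) p v w = fderiv ℝ f p (Γ p w v) + μ * f p * ricciSymm Γ p v w

/-- The system closes at first order: the derivative of f is read off from the jet itself, and the
derivative of df is given by the equation. -/
lemma IsSolutionAt.hasFDerivAt_jet {μ : ℝ} {f : Coord m → ℝ} (h : IsSolutionAt μ Γ f p)
    (hf : ContDiffAt ℝ 2 f p) :
    HasFDerivAt (fun q ↦ (f q, fderiv ℝ f q)) ((jetCoeff μ Γ p).flip (f p, fderiv ℝ f p)) p := by
  have he : (jetCoeff μ Γ p).flip (f p, fderiv ℝ f p) =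
      (fderiv ℝ f p).prod (fderiv ℝ (fderiv ℝ f) p) := by
    refine ContinuousLinearMap.ext fun v ↦ Prod.ext rfl (ContinuousLinearMap.ext fun w ↦ ?_)
    simp [jetCoeff_apply, h v w]
  rw [he]
  exact (hf.differentiableAt two_ne_zero).hasFDerivAt.prodMk
    hf.differentiableAt_fderiv.hasFDerivAt

/-- Affine Killing fields map solutions of the quasi-Einstein equation to solutions. -/
theorem IsSolutionAt.killing {μ : ℝ} {f : Coord m → ℝ} {s : Set (Coord m)} (hs : IsOpen s)
    (hp : p ∈ s) (hΓ : ContDiffOn ℝ ∞ Γ s) (hX : ContDiffOn ℝ ∞ X s) (hf : ContDiffOn ℝ ∞ f s)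
    (hK : ∀ q ∈ s, IsKillingAt Γ X q) (h : ∀ q ∈ s, IsSolutionAt μ Γ f q) :
    IsSolutionAt μ Γ (fun q ↦ fderiv ℝ f q (X q)) p := by
  have hsp := hs.mem_nhds hp
  have hf3 : ContDiffOn ℝ ∞ (fderiv ℝ f) s := hf.fderiv_of_isOpen hs (by simp)
  have hf4 : ContDiffOn ℝ ∞ (fderiv ℝ (fderiv ℝ f)) s := hf3.fderiv_of_isOpen hs (by simp)
  have hX2 : ContDiffOn ℝ ∞ (fderiv ℝ X) s := hX.fderiv_of_isOpen hs (by simp)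
  have D {F : Type} [NormedAddCommGroup F] [NormedSpace ℝ F] {g : Coord m → F}
      (hg : ContDiffOn ℝ ∞ g s) {q} (hq : q ∈ s) : DifferentiableAt ℝ g q :=
    (hg.contDiffAt (hs.mem_nhds hq)).differentiableAt (by simp)
  have cst {F : Type} [NormedAddCommGroup F] [NormedSpace ℝ F] (a : F) := hasDerivAt_const (0 : ℝ) a
  have h1 : ∀ q ∈ s, fderiv ℝ (fun q ↦ fderiv ℝ f q (X q)) q =
      (fderiv ℝ (fderiv ℝ f) q).flip (X q) + (fderiv ℝ f q).comp (fderiv ℝ X q) := by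
    intro q hq
    have := ((D hf3 hq).hasFDerivAt.clm_apply (D hX hq).hasFDerivAt).fderiv
    rw [this, add_comm]
  intro v w
  have hh : ContDiffOn ℝ ∞ (fun q ↦ fderiv ℝ f q (X q)) s := hf3.clm_apply hX
  have hh' := hh.fderiv_of_isOpen hs (m := ∞) (by simp)
  have e1 : fderiv ℝ (fderiv ℝ (fun q ↦ fderiv ℝ f q (X q))) p v w =
      fderiv ℝ (fderiv ℝ (fderiv ℝ f)) p v w (X p) + fderiv ℝ (fderiv ℝ f) p w (fderiv ℝ X p v) +
        (fderiv ℝ (fderiv ℝ f) p v (fderiv ℝ X p w) +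
          fderiv ℝ f p (fderiv ℝ (fderiv ℝ X) p v w)) := by
    have a1 := (hasDerivAt_line (D hh' hp) v).clm_apply (cst w)
    have a2 := (((hasDerivAt_line (D hf4 hp) v).clm_apply (cst w)).clm_apply
      (hasDerivAt_line (D hX hp) v)).add ((hasDerivAt_line (D hf3 hp) v).clm_apply
      ((hasDerivAt_line (D hX2 hp) v).clm_apply (cst w)))
    have := a1.unique (a2.congr_of_eventuallyEq
      ((eventually_line hsp v).mono fun t ht ↦ by simp [h1 _ ht]))
    simpa using this
  have s1 {q} (hq : q ∈ s) (a b) :=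
    ((hf.contDiffAt (hs.mem_nhds hq)).of_le (m := 2) ENat.LEInfty.out).fderiv_swap a b
  -- Symmetry of the third derivative turns it into the derivative along X of the second derivative,
  -- to which the equation applies.
  have e2 : fderiv ℝ (fderiv ℝ (fderiv ℝ f)) p v w (X p) =
      fderiv ℝ (fderiv ℝ (fderiv ℝ f)) p (X p) v w := by
    rw [← ((hf3.contDiffAt hsp).of_le (m := 2) ENat.LEInfty.out).fderiv_swap v]
    have a1 (a b : Coord m) :=
      ((hasDerivAt_line (D hf4 hp) v).clm_apply (cst a)).clm_apply (cst b)
    have := (a1 w (X p)).unique ((a1 (X p) w).congr_of_eventuallyEq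
      ((eventually_line hsp v).mono fun t ht ↦ s1 ht w (X p)))
    simpa using this
  -- The equation differentiated along X, with the derivative of the Ricci tensor given by its
  -- Killing invariance.
  have e3 : fderiv ℝ (fderiv ℝ (fderiv ℝ f)) p (X p) v w =
      fderiv ℝ (fderiv ℝ f) p (X p) (Γ p w v) + fderiv ℝ f p (fderiv ℝ Γ p (X p) w v) +
        (μ * fderiv ℝ f p (X p) * ricciSymm Γ p v w +
        μ * f p * (- ricciSymm Γ p (fderiv ℝ X p v) w - ricciSymm Γ p v (fderiv ℝ X p w))) := by
    have a1 := ((hasDerivAt_line (D hf4 hp) (X p)).clm_apply (cst v)).clm_apply (cst w)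
    have r1 (a b : Coord m) := hasDerivAt_line (D (contDiffOn_ricci hs (by simp) hΓ a b) hp) (X p)
    have r2 := ((r1 v w).add (r1 w v)).const_mul (1 / 2 : ℝ)
    rw [IsKillingAt.fderiv_ricci hs hp hΓ hX hK, IsKillingAt.fderiv_ricci hs hp hΓ hX hK] at r2
    have a2 := ((hasDerivAt_line (D hf3 hp) (X p)).clm_apply
      (((hasDerivAt_line (D hΓ hp) (X p)).clm_apply (cst w)).clm_apply (cst v))).add
      (((hasDerivAt_line (D hf hp) (X p)).const_mul μ).mul r2)
    have := a1.unique (a2.congr_of_eventuallyEq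
      ((eventually_line hsp (X p)).mono fun t ht ↦ h _ ht v w))
    simp only [map_zero, add_zero, zero_smul, Pi.add_apply] at this
    rw [this, ricciSymm_apply, ricciSymm_apply, ricciSymm_apply]
    ring
  -- The Killing equation eliminates the derivative of Γ along X. The terms in which the derivative
  -- of X hits v or w cancel by the equation evaluated on those vectors.
  rw [e1, e2, e3, h1 p hp, hK p hp]
  have := h p hp (fderiv ℝ X p v) w
  rw [s1 hp w, this, h p hp v, s1 hp (X p)]
  simp
  ring

end FlatConnection

/-! ### Transfer of the geometric objects to a chart -/

noncomputable section

namespace AffineConnection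

variable {m : ℕ} {M : Type*} [TopologicalSpace M] [ChartedSpace (Coord m) M]
  [IsManifold (𝓡 m) ∞ M] {P y : M}

/-- A C^n connection differentiates C^(n+1) fields, while the frame is known to be C^n; hence n + 1
= n is required, to be used for ∞ and ω. -/
theorem contDiffOn_christoffel (D : AffineConnection m M) {n : ℕ∞ω} [IsManifold (𝓡 m) n M]
    [ContMDiffVectorBundle n (Coord m) (TangentSpace (𝓡 m) : M → Type _) (𝓡 m)]
    (hn : n + 1 = n)
    (hD : ∀ U : Set M, IsOpen U → ContMDiffCovariantDerivativeOn (Coord m) n D.toFun U) :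
    ContDiffOn ℝ n (christoffel D P) (extChartAt (𝓡 m) P).target := by
  unfold christoffel
  refine ContDiffOn.sum fun i _ ↦ ?_
  let e : Coord m := EuclideanSpace.single i 1
  have hfr : ContMDiffOn (𝓡 m) ((𝓡 m).prod (𝓡 m)) (n + 1)
      (fun x ↦ (frame P e x : TangentBundle (𝓡 m) M)) (extChartAt (𝓡 m) P).source := by
    rw [hn]
    exact fun y hy ↦ (contMDiffAt_frame hy e).contMDiffWithinAt
  have h1 := (hD _ (isOpen_extChartAt_source P)).contMDiff hfr
  intro p hp
  have hy := (extChartAt (𝓡 m) P).map_target hp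
  have h2 := h1.contMDiffAt ((isOpen_extChartAt_source P).mem_nhds hy)
  -- In the trivialization of the Hom bundle the section ∇e is exactly the `inCoordinates` operator
  -- in the definition of `christoffel`.
  have h3 := ((trivializationAt (Coord m →L[ℝ] Coord m)
    (fun x : M ↦ TangentSpace (𝓡 m) x →L[ℝ] TangentSpace (𝓡 m) x) P).contMDiffAt_section_iff
      (by rw [hom_trivializationAt_baseSet]; exact ⟨mem_baseSet_iff.2 hy,
        mem_baseSet_iff.2 hy⟩)).1 h2
  have h4 := (contDiffAt_comp_symm_iff hy).1 h3
  rw [PartialEquiv.right_inv _ hp] at h4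
  exact (ContDiffAt.clm_apply (𝕜 := ℝ) contDiffAt_const h4 : ContDiffAt ℝ n (fun q ↦
    (ContinuousLinearMap.smulRightL ℝ (Coord m) (Coord m →L[ℝ] Coord m)
      (EuclideanSpace.proj i)) _) p).contDiffWithinAt

variable {X Y Z : Π x : M, TangentSpace (𝓡 m) x}

/-- Smoothness of a vector field in a neighborhood of a point. -/
def SmoothAt (X : Π x : M, TangentSpace (𝓡 m) x) (y : M) : Prop :=
  ∀ᶠ z in 𝓝 y, ContMDiffAt (𝓡 m) ((𝓡 m).prod (𝓡 m)) ∞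
    (fun x ↦ (X x : TangentBundle (𝓡 m) M)) z

lemma SmoothAt.mdifferentiableAt (hX : SmoothAt X y) :
    MDifferentiableAt (𝓡 m) ((𝓡 m).prod (𝓡 m)) (fun x ↦ (X x : TangentBundle (𝓡 m) M)) y :=
  hX.self_of_nhds.mdifferentiableAt (by simp)

lemma SmoothAt.eventually (hX : SmoothAt X y) : ∀ᶠ z in 𝓝 y, SmoothAt X z :=
  eventually_eventually_nhds.2 hX

lemma SmoothAt.contDiffAt_hat (hX : SmoothAt X y) (hy : y ∈ (extChartAt (𝓡 m) P).source) :
    ContDiffAt ℝ ∞ (hat P X) (extChartAt (𝓡 m) P y) :=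
  (contMDiffAt_section_iff_hat hy).1 hX.self_of_nhds

lemma eventually_extChartAt_symm (hy : y ∈ (extChartAt (𝓡 m) P).source) {Q : M → Prop}
    (h : ∀ᶠ z in 𝓝 y, Q z) : ∀ᶠ p in 𝓝 (extChartAt (𝓡 m) P y), p ∈ (extChartAt (𝓡 m) P).target ∧
      Q ((extChartAt (𝓡 m) P).symm p) := by
  have hc := continuousAt_extChartAt_symm' hy
  rw [ContinuousAt, PartialEquiv.left_inv _ hy] at hc
  exact (eventually_mem_target ((extChartAt (𝓡 m) P).map_source hy)).and (hc.eventually h)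

lemma coordAt_nabla (D : AffineConnection m M) (hY : SmoothAt Y y)
    (hy : y ∈ (extChartAt (𝓡 m) P).source) :
    coordAt P y (D.nabla X Y y) =
      FlatConnection.nabla (christoffel D P) (hat P X) (hat P Y) (extChartAt (𝓡 m) P y) := by
  rw [nabla, coordAt_toFun D hy hY.mdifferentiableAt, FlatConnection.nabla, hat_extChartAt hy,
    hat_extChartAt hy]

lemma hat_nabla_eventuallyEq (D : AffineConnection m M) (hY : SmoothAt Y y)
    (hy : y ∈ (extChartAt (𝓡 m) P).source) :
    hat P (D.nabla X Y) =ᶠ[𝓝 (extChartAt (𝓡 m) P y)]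
      FlatConnection.nabla (christoffel D P) (hat P X) (hat P Y) := by
  filter_upwards [eventually_extChartAt_symm hy hY.eventually] with p ⟨hp, hYp⟩
  rw [hat, coordAt_nabla D hYp ((extChartAt (𝓡 m) P).map_target hp), PartialEquiv.right_inv _ hp]

lemma contDiffOn_christoffel_infty (D : AffineConnection m M) (P : M) :
    ContDiffOn ℝ ∞ (christoffel D P) (extChartAt (𝓡 m) P).target :=
  contDiffOn_christoffel D rfl D.smooth

lemma contDiffAt_christoffel (D : AffineConnection m M)
    (hy : y ∈ (extChartAt (𝓡 m) P).source) :
    ContDiffAt ℝ ∞ (christoffel D P) (extChartAt (𝓡 m) P y) :=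
  (contDiffOn_christoffel_infty D P).contDiffAt
    ((isOpen_target P).mem_nhds ((extChartAt (𝓡 m) P).map_source hy))

lemma SmoothAt.nabla (D : AffineConnection m M) (hX : SmoothAt X y) (hY : SmoothAt Y y) :
    SmoothAt (D.nabla X Y) y := by
  filter_upwards [hX.eventually, hY.eventually] with z hX hY
  have hz : z ∈ (extChartAt (𝓡 m) z).source := mem_extChartAt_source z
  refine (contMDiffAt_section_iff_hat hz).2 (ContDiffAt.congr_of_eventuallyEq ?_
    (hat_nabla_eventuallyEq D hY hz))
  exact (((hY.contDiffAt_hat hz).fderiv_right (m := ∞) (by simp)).clm_apply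
    (hX.contDiffAt_hat hz)).add (((contDiffAt_christoffel D hz).clm_apply
      (hY.contDiffAt_hat hz)).clm_apply (hX.contDiffAt_hat hz))

/-- Identifies components with a pullback, so that naturality of the Lie bracket yields its
coordinate formula. -/
lemma hat_eq_mpullback {p : Coord m} (hp : p ∈ (extChartAt (𝓡 m) P).target) :
    mpullback 𝓘(ℝ, Coord m) (𝓡 m) (extChartAt (𝓡 m) P).symm X p = hat P X p := by
  have hy := (extChartAt (𝓡 m) P).map_target hp
  have h1 : coordSymm P ((extChartAt (𝓡 m) P).symm p) =
      mfderiv 𝓘(ℝ, Coord m) (𝓡 m) (extChartAt (𝓡 m) P).symm p := by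
    have := TangentBundle.symmL_trivializationAt (I := 𝓡 m) (𝕜 := ℝ) (x₀ := P)
      (x := (extChartAt (𝓡 m) P).symm p) (by simpa using hy)
    rw [PartialEquiv.right_inv _ hp] at this
    rw [coordSymm]
    refine this.trans ?_
    rw [ModelWithCorners.range_eq_univ, mfderivWithin_univ]
  rw [mpullback_apply, hat, ← h1]
  have := ContinuousLinearMap.inverse_eq (f := coordSymm P ((extChartAt (𝓡 m) P).symm p))
    (g := coordAt P ((extChartAt (𝓡 m) P).symm p))
    (ContinuousLinearMap.ext (coordSymm_coordAt hy))
    (ContinuousLinearMap.ext (coordAt_coordSymm hy))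
  exact congrArg (fun L : TangentSpace (𝓡 m) ((extChartAt (𝓡 m) P).symm p) →L[ℝ] Coord m ↦
    L (X ((extChartAt (𝓡 m) P).symm p))) this

lemma coordAt_mlieBracket (hX : SmoothAt X y) (hY : SmoothAt Y y)
    (hy : y ∈ (extChartAt (𝓡 m) P).source) :
    coordAt P y (mlieBracket (𝓡 m) X Y y) =
      lieBracket ℝ (hat P X) (hat P Y) (extChartAt (𝓡 m) P y) := by
  have hp := (extChartAt (𝓡 m) P).map_source hy
  have hl := PartialEquiv.left_inv _ hy
  have hmin : minSmoothness ℝ 2 = 2 := minSmoothness_of_isRCLikeNormedField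
  have : IsManifold (𝓡 m) (minSmoothness ℝ 2) M := by
    rw [hmin]; exact .of_le (n := ∞) ENat.LEInfty.out
  rw [← hat_extChartAt hy, ← hat_eq_mpullback hp, mpullback_mlieBracket (n := ∞)
    (by rw [hl]; exact hX.mdifferentiableAt) (by rw [hl]; exact hY.mdifferentiableAt)
    ((contMDiffOn_extChartAt_symm P).contMDiffAt ((isOpen_target P).mem_nhds hp))
    (by rw [hmin]; exact ENat.LEInfty.out), ← mlieBracketWithin_univ,
    mlieBracketWithin_eq_lieBracketWithin]
  refine (congrFun (lieBracketWithin_univ (𝕜 := ℝ) (E := Coord m)) _).trans ?_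
  refine Filter.EventuallyEq.lieBracket_vectorField_eq ?_ ?_ <;>
  filter_upwards [eventually_mem_target hp] with q hq using hat_eq_mpullback hq

lemma hat_mlieBracket_eventuallyEq (hX : SmoothAt X y) (hY : SmoothAt Y y)
    (hy : y ∈ (extChartAt (𝓡 m) P).source) :
    hat P (mlieBracket (𝓡 m) X Y) =ᶠ[𝓝 (extChartAt (𝓡 m) P y)]
      lieBracket ℝ (hat P X) (hat P Y) := by
  filter_upwards [eventually_extChartAt_symm hy (hX.eventually.and hY.eventually)]
    with p ⟨hp, hXp, hYp⟩
  rw [hat, coordAt_mlieBracket hXp hYp ((extChartAt (𝓡 m) P).map_target hp),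
    PartialEquiv.right_inv _ hp]

lemma SmoothAt.mlieBracket (hX : SmoothAt X y) (hY : SmoothAt Y y) :
    SmoothAt (mlieBracket (𝓡 m) X Y) y := by
  filter_upwards [hX.eventually, hY.eventually] with z hX hY
  have hz : z ∈ (extChartAt (𝓡 m) z).source := mem_extChartAt_source z
  refine (contMDiffAt_section_iff_hat hz).2 (ContDiffAt.congr_of_eventuallyEq ?_
    (hat_mlieBracket_eventuallyEq hX hY hz))
  have hX' := hX.contDiffAt_hat hz
  have hY' := hY.contDiffAt_hat hz
  exact ((hY'.fderiv_right (m := ∞) (by simp)).clm_apply hX').sub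
    ((hX'.fderiv_right (m := ∞) (by simp)).clm_apply hY')

lemma nabla_congr {E : Type*} [NormedAddCommGroup E] [NormedSpace ℝ E]
    {Γ : E → E →L[ℝ] E →L[ℝ] E} {X Y Y' : E → E} {p : E} (h : Y =ᶠ[𝓝 p] Y') :
    FlatConnection.nabla Γ X Y p = FlatConnection.nabla Γ X Y' p := by
  rw [FlatConnection.nabla, FlatConnection.nabla, h.fderiv_eq, h.self_of_nhds]

/-- The outer covariant derivatives see the inner ones near the point, so the inner ones are
replaced as germs before `curvature_eq` applies. The result depends only on the values of the fields
at y, hence not on how vectors are extended. -/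
theorem coordAt_curvature (D : AffineConnection m M) (hX : SmoothAt X y) (hY : SmoothAt Y y)
    (hZ : SmoothAt Z y) (hy : y ∈ (extChartAt (𝓡 m) P).source) :
    coordAt P y (D.curvature X Y Z y) =
      FlatConnection.curvature (christoffel D P) (extChartAt (𝓡 m) P y)
        (coordAt P y (X y)) (coordAt P y (Y y)) (coordAt P y (Z y)) := by
  have hX' := hX.contDiffAt_hat hy
  have hY' := hY.contDiffAt_hat hy
  have hZ' := hZ.contDiffAt_hat hy
  rw [← hat_extChartAt hy X, ← hat_extChartAt hy Y, ← hat_extChartAt hy Z,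
    ← FlatConnection.curvature_eq ((contDiffAt_christoffel D hy).of_le (by simp))
      (hX'.of_le (by simp)) (hY'.of_le (by simp)) (hZ'.of_le ENat.LEInfty.out),
    ← nabla_congr (hat_nabla_eventuallyEq D hZ hy), ← nabla_congr (hat_nabla_eventuallyEq D hZ hy),
    ← coordAt_nabla D (.nabla D hY hZ) hy, ← coordAt_nabla D (.nabla D hX hZ) hy]
  have h1 : coordAt P y (D.nabla (mlieBracket (𝓡 m) X Y) Z y) = FlatConnection.nabla
      (christoffel D P) (lieBracket ℝ (hat P X) (hat P Y)) (hat P Z) (extChartAt (𝓡 m) P y) := by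
    rw [coordAt_nabla D hZ hy, FlatConnection.nabla, FlatConnection.nabla,
      (hat_mlieBracket_eventuallyEq hX hY hy).self_of_nhds]
  rw [← h1, ← map_sub, ← map_sub]
  rfl

lemma smoothAt_frame (hy : y ∈ (extChartAt (𝓡 m) P).source) (w : Coord m) :
    SmoothAt (frame P w) y := by
  filter_upwards [eventually_mem_source hy] with z hz using contMDiffAt_frame hz w

lemma smoothAt_constField (v : TangentSpace (𝓡 m) y) : SmoothAt (constField v) y := by
  rw [constField_eq]
  exact smoothAt_frame (mem_extChartAt_source y) v

lemma constField_self (v : TangentSpace (𝓡 m) y) : constField v y = v :=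
  FiberBundle.extend_apply_self (Coord m) v

/-- `ricci` contracts over the standard basis of T_y M, which belongs to the chart preferred at y,
whereas the coordinates belong to the chart at P. The two endomorphisms are conjugate by `coordAt P
y`, so their traces agree. -/
theorem ricci_eq (D : AffineConnection m M) (hy : y ∈ (extChartAt (𝓡 m) P).source)
    (v w : TangentSpace (𝓡 m) y) :
    D.ricci y v w = FlatConnection.ricci (christoffel D P) (extChartAt (𝓡 m) P y)
      (coordAt P y v) (coordAt P y w) := by
  let L : Coord m →ₗ[ℝ] Coord m := (coordAt P y).toLinearMap
  let S : Coord m →ₗ[ℝ] Coord m := (coordSymm P y).toLinearMap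
  have hLS : L * S = 1 := LinearMap.ext (coordAt_coordSymm hy)
  let T := FlatConnection.curvatureLin (christoffel D P) (extChartAt (𝓡 m) P y)
    (coordAt P y v) (coordAt P y w)
  have h1 (e : TangentSpace (𝓡 m) y) :
      D.curvature (constField e) (constField v) (constField w) y = (S * T * L) e := by
    apply coordAt_injective hy
    rw [coordAt_curvature D (smoothAt_constField _) (smoothAt_constField v)
      (smoothAt_constField w) hy, constField_self, constField_self, constField_self]
    exact (coordAt_coordSymm hy _).symm
  have h2 : D.ricci y v w = ∑ i, (S * T * L) (EuclideanSpace.single i 1) i := by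
    unfold ricci
    exact Finset.sum_congr rfl fun i _ ↦ congrArg (fun z : Coord m ↦ z i) (h1 _)
  rw [h2, FlatConnection.sum_coord_eq_trace, FlatConnection.ricci_eq_trace, mul_assoc,
    LinearMap.trace_mul_comm, mul_assoc, hLS, mul_one]

theorem ricciSymm_eq (D : AffineConnection m M) (hy : y ∈ (extChartAt (𝓡 m) P).source)
    (v w : TangentSpace (𝓡 m) y) :
    D.ricciSymm y v w = FlatConnection.ricciSymm (christoffel D P) (extChartAt (𝓡 m) P y)
      (coordAt P y v) (coordAt P y w) := by
  rw [ricciSymm, ricci_eq D hy, ricci_eq D hy, FlatConnection.ricciSymm_apply]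

/-- The derivative of the components of the extension of w occurs in both v(Wf) and (∇_v W)f and
cancels, leaving the Christoffel term. -/
theorem hessian_eq (D : AffineConnection m M) (hy : y ∈ (extChartAt (𝓡 m) P).source)
    {f : M → ℝ} (hf : ContMDiffAt (𝓡 m) 𝓘(ℝ, ℝ) 2 f y) (v w : TangentSpace (𝓡 m) y) :
    D.hessian f y v w =
      fderiv ℝ (fderiv ℝ (f ∘ (extChartAt (𝓡 m) P).symm)) (extChartAt (𝓡 m) P y)
        (coordAt P y v) (coordAt P y w) -
      fderiv ℝ (f ∘ (extChartAt (𝓡 m) P).symm) (extChartAt (𝓡 m) P y)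
        (christoffel D P (extChartAt (𝓡 m) P y) (coordAt P y w) (coordAt P y v)) := by
  have : IsManifold (𝓡 m) 2 M := .of_le (n := ∞) ENat.LEInfty.out
  have hf' := (contDiffAt_comp_symm_iff hy).1 hf
  have hW := smoothAt_constField w
  have hev : ∀ᶠ z in 𝓝 y, ContMDiffAt (𝓡 m) 𝓘(ℝ, ℝ) 2 f z :=
    (contMDiffAt_iff_contMDiffAt_nhds (by simp)).1 hf
  have h1 := mdifferentiableAt_mvfderiv_constField hf w
  have h2 : (fun z ↦ mvfderiv (𝓡 m) f z (constField w z)) ∘ (extChartAt (𝓡 m) P).symm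
      =ᶠ[𝓝 (extChartAt (𝓡 m) P y)] fun p ↦
        fderiv ℝ (f ∘ (extChartAt (𝓡 m) P).symm) p (hat P (constField w) p) := by
    filter_upwards [eventually_extChartAt_symm hy hev] with p ⟨hp, hfp⟩
    rw [Function.comp_apply, mvfderiv_eq ((extChartAt (𝓡 m) P).map_target hp)
      (hfp.mdifferentiableAt two_ne_zero), PartialEquiv.right_inv _ hp]
    rfl
  have h3 := (hf'.differentiableAt_fderiv.hasFDerivAt.clm_apply
    (differentiableAt_hat hy hW.mdifferentiableAt).hasFDerivAt).fderiv
  rw [hessian, mvfderiv_eq hy h1, h2.fderiv_eq, h3,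
    mvfderiv_eq hy (hf.mdifferentiableAt two_ne_zero), coordAt_toFun D hy hW.mdifferentiableAt,
    hat_extChartAt hy, constField_self]
  simp only [add_apply, map_add, ContinuousLinearMap.flip_apply, ContinuousLinearMap.comp_apply]
  ring

/-- The quasi-Einstein equation at a point, in coordinates. -/
theorem isSolutionAt_iff (D : AffineConnection m M) (μ : ℝ)
    (hy : y ∈ (extChartAt (𝓡 m) P).source) {f : M → ℝ}
    (hf : ContMDiffAt (𝓡 m) 𝓘(ℝ, ℝ) 2 f y) :
    (∀ v w : TangentSpace (𝓡 m) y, D.hessian f y v w = μ * f y * D.ricciSymm y v w) ↔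
    FlatConnection.IsSolutionAt μ (christoffel D P) (f ∘ (extChartAt (𝓡 m) P).symm)
      (extChartAt (𝓡 m) P y) := by
  constructor
  · intro h v w
    have := h (coordSymm P y v) (coordSymm P y w)
    rw [hessian_eq D hy hf, ricciSymm_eq D hy, coordAt_coordSymm hy, coordAt_coordSymm hy] at this
    rw [Function.comp_apply, PartialEquiv.left_inv _ hy]
    linarith
  · intro h v w
    have := h (coordAt P y v) (coordAt P y w)
    rw [Function.comp_apply, PartialEquiv.left_inv _ hy] at this
    rw [hessian_eq D hy hf, ricciSymm_eq D hy]
    linarith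

end AffineConnection

end

/-! ### Local theory: regularity, unique continuation, dimension bound, Killing fields -/

noncomputable section

namespace AffineConnection

variable {m : ℕ} {M : Type*} [TopologicalSpace M] [ChartedSpace (Coord m) M]
  [IsManifold (𝓡 m) ∞ M] {P y : M} {μ : ℝ} {D : AffineConnection m M} {f : M → ℝ} {U : Set M}

/-- The 1-jet of a function in the preferred chart at `P`. -/
def jet (P : M) (f : M → ℝ) (p : Coord m) : ℝ × (Coord m →L[ℝ] ℝ) :=
  ((f ∘ (extChartAt (𝓡 m) P).symm) p, fderiv ℝ (f ∘ (extChartAt (𝓡 m) P).symm) p)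

lemma QuasiEinsteinOn.isSolutionAt (hU : IsOpen U) (hf : ContMDiffOn (𝓡 m) 𝓘(ℝ, ℝ) 2 f U)
    (h : D.QuasiEinsteinOn μ f U) {p : Coord m}
    (hp : p ∈ (extChartAt (𝓡 m) P).target ∩ (extChartAt (𝓡 m) P).symm ⁻¹' U) :
    FlatConnection.IsSolutionAt μ (christoffel D P) (f ∘ (extChartAt (𝓡 m) P).symm) p := by
  have := (isSolutionAt_iff D μ ((extChartAt (𝓡 m) P).map_target hp.1)
    (hf.contMDiffAt (hU.mem_nhds hp.2))).1 (h _ hp.2)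
  rwa [PartialEquiv.right_inv _ hp.1] at this

lemma contDiffAt_comp_symm {n : ℕ∞ω} [IsManifold (𝓡 m) n M] (hU : IsOpen U)
    (hf : ContMDiffOn (𝓡 m) 𝓘(ℝ, ℝ) n f U) {p : Coord m}
    (hp : p ∈ (extChartAt (𝓡 m) P).target ∩ (extChartAt (𝓡 m) P).symm ⁻¹' U) :
    ContDiffAt ℝ n (f ∘ (extChartAt (𝓡 m) P).symm) p := by
  have := (contDiffAt_comp_symm_iff ((extChartAt (𝓡 m) P).map_target hp.1)).1
    (hf.contMDiffAt (hU.mem_nhds hp.2))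
  rwa [PartialEquiv.right_inv _ hp.1] at this

lemma isManifold_two : IsManifold (𝓡 m) 2 M := .of_le (n := ∞) ENat.LEInfty.out

lemma QuasiEinsteinOn.hasFDerivAt_jet (hU : IsOpen U) (hf : ContMDiffOn (𝓡 m) 𝓘(ℝ, ℝ) 2 f U)
    (h : D.QuasiEinsteinOn μ f U) {p : Coord m}
    (hp : p ∈ (extChartAt (𝓡 m) P).target ∩ (extChartAt (𝓡 m) P).symm ⁻¹' U) :
    HasFDerivAt (jet P f)
      ((FlatConnection.jetCoeff μ (christoffel D P) p).flip (jet P f p)) p :=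
  have := isManifold_two (m := m) (M := M)
  (h.isSolutionAt hU hf hp).hasFDerivAt_jet (contDiffAt_comp_symm hU hf hp)

lemma mem_target_inter (hy : y ∈ U) : extChartAt (𝓡 m) y y ∈
    (extChartAt (𝓡 m) y).target ∩ (extChartAt (𝓡 m) y).symm ⁻¹' U :=
  ⟨mem_extChartAt_target y, by rwa [mem_preimage, extChartAt_to_inv]⟩

/-- A `C^2` solution of the quasi-Einstein equation is smooth. -/
theorem QuasiEinsteinOn.contMDiffOn_infty (hU : IsOpen U)
    (hf : ContMDiffOn (𝓡 m) 𝓘(ℝ, ℝ) 2 f U) (h : D.QuasiEinsteinOn μ f U) :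
    ContMDiffOn (𝓡 m) 𝓘(ℝ, ℝ) ∞ f U := by
  intro y hy
  have hs := isOpen_target_inter (m := m) y hU
  have h1 := LinearTotalSystem.contDiffOn_infty hs
    (FlatConnection.contDiffOn_jetCoeff μ hs (n := ∞) (by simp)
      ((contDiffOn_christoffel_infty D y).mono inter_subset_left))
    (fun p hp ↦ h.hasFDerivAt_jet hU hf hp)
  have h2 := h1.contDiffAt (hs.mem_nhds (mem_target_inter hy))
  exact ((contDiffAt_comp_symm_iff (mem_extChartAt_source y)).2
    (contDiff_fst.contDiffAt.comp _ h2)).contMDiffWithinAt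

/-- A `C^2` solution of the quasi-Einstein equation is real analytic if the connection is. -/
theorem QuasiEinsteinOn.contMDiffOn_omega [IsManifold (𝓡 m) ω M] (hD : D.IsAnalytic)
    (hU : IsOpen U) (hf : ContMDiffOn (𝓡 m) 𝓘(ℝ, ℝ) 2 f U) (h : D.QuasiEinsteinOn μ f U) :
    ContMDiffOn (𝓡 m) 𝓘(ℝ, ℝ) ω f U := by
  intro y hy
  have hs := isOpen_target_inter (m := m) y hU
  have hsy := hs.mem_nhds (mem_target_inter hy)
  have hA := ((FlatConnection.contDiffOn_jetCoeff μ hs (n := ω) le_rfl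
    ((contDiffOn_christoffel D rfl hD).mono inter_subset_left)).contDiffAt hsy).analyticAt
  have h2 := (LinearTotalSystem.analyticAt hA (Filter.mem_of_superset hsy
    fun p hp ↦ h.hasFDerivAt_jet hU hf hp)).contDiffAt (n := ω)
  exact ((contDiffAt_comp_symm_iff (mem_extChartAt_source y)).2
    (contDiff_fst.contDiffAt.comp _ h2)).contMDiffWithinAt

/-- A solution vanishes on a convex coordinate domain if its 1-jet vanishes at a point. -/
lemma QuasiEinsteinOn.eq_zero_of_jet_eq_zero (hU : IsOpen U)
    (hf : ContMDiffOn (𝓡 m) 𝓘(ℝ, ℝ) 2 f U) (h : D.QuasiEinsteinOn μ f U) {C : Set (Coord m)}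
    (hC : Convex ℝ C)
    (hCU : C ⊆ (extChartAt (𝓡 m) P).target ∩ (extChartAt (𝓡 m) P).symm ⁻¹' U) {p : Coord m}
    (hp : p ∈ C) (h0 : jet P f p = 0) :
    ∀ q ∈ C, f ((extChartAt (𝓡 m) P).symm q) = 0 := by
  intro q hq
  have hs := isOpen_target_inter (m := m) P hU
  have := LinearTotalSystem.eq_zero_of_convex hC
    ((FlatConnection.contDiffOn_jetCoeff μ hs (n := ∞) (by simp)
      ((contDiffOn_christoffel_infty D P).mono inter_subset_left)).continuousOn.mono hCU)
    (fun p hp ↦ h.hasFDerivAt_jet hU hf (hCU hp)) hp h0 q hq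
  exact congrArg Prod.fst this

/-- A coordinate ball around a point. -/
def chartBall (P : M) (r : ℝ) : Set M :=
  (extChartAt (𝓡 m) P).symm '' Metric.ball (extChartAt (𝓡 m) P P) r

lemma exists_ball_subset (hU : U ∈ 𝓝 P) : ∃ r > 0, Metric.ball (extChartAt (𝓡 m) P P) r ⊆
    (extChartAt (𝓡 m) P).target ∩ (extChartAt (𝓡 m) P).symm ⁻¹' interior U :=
  Metric.isOpen_iff.1 (isOpen_target_inter (m := m) P isOpen_interior) _
    (mem_target_inter (mem_interior_iff_mem_nhds.2 hU))

lemma isOpen_chartBall {r : ℝ}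
    (h : Metric.ball (extChartAt (𝓡 m) P P) r ⊆ (extChartAt (𝓡 m) P).target) :
    IsOpen (chartBall (m := m) P r) := by
  rw [chartBall, PartialEquiv.symm_image_eq_source_inter_preimage _ h]
  exact (continuousOn_extChartAt P).isOpen_inter_preimage (isOpen_extChartAt_source P)
    Metric.isOpen_ball

lemma isPreconnected_chartBall {r : ℝ}
    (h : Metric.ball (extChartAt (𝓡 m) P P) r ⊆ (extChartAt (𝓡 m) P).target) :
    IsPreconnected (chartBall (m := m) P r) :=
  (convex_ball _ _).isPreconnected.image _ ((continuousOn_extChartAt_symm P).mono h)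

lemma mem_chartBall {r : ℝ} (hr : 0 < r) : P ∈ chartBall (m := m) P r :=
  ⟨_, Metric.mem_ball_self hr, extChartAt_to_inv P⟩

lemma jet_eq_zero_of_eventuallyEq {p : Coord m} (hp : p ∈ (extChartAt (𝓡 m) P).target)
    (h : ∀ᶠ z in 𝓝 ((extChartAt (𝓡 m) P).symm p), f z = 0) : jet P f p = 0 := by
  have h1 : f ∘ (extChartAt (𝓡 m) P).symm =ᶠ[𝓝 p] fun _ ↦ (0 : ℝ) :=
    (((continuousOn_extChartAt_symm P).continuousAt ((isOpen_target P).mem_nhds hp)).eventually h)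
  rw [jet, h1.self_of_nhds, h1.fderiv_eq]
  simp

/-- Unique continuation for the quasi-Einstein equation. -/
theorem QuasiEinsteinOn.eq_zero_of_isPreconnected (hU : IsOpen U)
    (hf : ContMDiffOn (𝓡 m) 𝓘(ℝ, ℝ) 2 f U) (h : D.QuasiEinsteinOn μ f U) {V : Set M}
    (hV : IsPreconnected V) (hVU : V ⊆ U) (hPV : P ∈ V) (h0 : ∀ᶠ x in 𝓝 P, f x = 0) :
    ∀ x ∈ V, f x = 0 := by
  -- The set where f vanishes locally is open; it remains to see that it is relatively closed in V.
  have key : V ⊆ {x | ∀ᶠ z in 𝓝 x, f z = 0} := by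
    refine hV.subset_of_closure_inter_subset isOpen_setOfPred_eventually_nhds ⟨P, hPV, h0⟩ ?_
    rintro x ⟨hx, hxV⟩
    obtain ⟨r, hr, hb⟩ := exists_ball_subset (m := m) (hU.mem_nhds (hVU hxV))
    rw [hU.interior_eq] at hb
    have hbt := hb.trans inter_subset_left
    have hnhds := (isOpen_chartBall hbt).mem_nhds (mem_chartBall (m := m) hr)
    -- A coordinate ball around the limit point x contains a point near which f vanishes. The jet is
    -- zero there, so f vanishes on the whole ball, by convexity.
    obtain ⟨_, ⟨p, hp, rfl⟩, hz⟩ := mem_closure_iff_nhds.1 hx _ hnhds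
    have := h.eq_zero_of_jet_eq_zero hU hf (convex_ball _ _) hb hp
      (jet_eq_zero_of_eventuallyEq (hbt hp) hz)
    filter_upwards [hnhds]
    rintro _ ⟨q, hq, rfl⟩
    exact this q hq
  exact fun x hx ↦ (key hx).self_of_nhds

lemma mem_germSolutions_iff {f : M → ℝ} : (f : Germ (𝓝 P) ℝ) ∈ D.germSolutions μ P ↔
    ∃ (U : Set M) (g : M → ℝ), IsOpen U ∧ P ∈ U ∧ ContMDiffOn (𝓡 m) 𝓘(ℝ, ℝ) ∞ g U ∧
      D.QuasiEinsteinOn μ g U ∧ g =ᶠ[𝓝 P] f := by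
  change (∃ (U : Set M) (g : M → ℝ), IsOpen U ∧ P ∈ U ∧
    ContMDiffOn (𝓡 m) 𝓘(ℝ, ℝ) ∞ g U ∧ D.QuasiEinsteinOn μ g U ∧
      (g : Germ (𝓝 P) ℝ) = (f : Germ (𝓝 P) ℝ)) ↔ _
  simp only [Germ.coe_eq]

/-- A germ of a solution with vanishing 1-jet vanishes. -/
theorem eventually_eq_zero_of_germ (hf : (f : Germ (𝓝 P) ℝ) ∈ D.germSolutions μ P)
    (h0 : f P = 0) (h1 : mvfderiv (𝓡 m) f P = 0) : ∀ᶠ x in 𝓝 P, f x = 0 := by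
  obtain ⟨U, g, hU, hPU, hg, hgE, hgf⟩ := mem_germSolutions_iff.1 hf
  have hP := mem_extChartAt_source (I := 𝓡 m) P
  have hg2 : ContMDiffOn (𝓡 m) 𝓘(ℝ, ℝ) 2 g U := hg.of_le ENat.LEInfty.out
  obtain ⟨r, hr, hb⟩ := exists_ball_subset (m := m) (hU.mem_nhds hPU)
  rw [hU.interior_eq] at hb
  have hj : jet P g (extChartAt (𝓡 m) P P) = 0 := by
    refine Prod.ext ?_ (ContinuousLinearMap.ext fun v ↦ ?_)
    · change g ((extChartAt (𝓡 m) P).symm _) = 0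
      rw [extChartAt_to_inv, hgf.self_of_nhds, h0]
    · have := mvfderiv_eq hP ((hg2.contMDiffAt (hU.mem_nhds hPU)).mdifferentiableAt two_ne_zero)
        (coordSymm P P v)
      rw [coordAt_coordSymm hP, mvfderiv_congr hgf, h1] at this
      exact this.symm
  have h2 := hgE.eq_zero_of_jet_eq_zero hU hg2 (convex_ball _ _) hb (Metric.mem_ball_self hr) hj
  filter_upwards [hgf, (isOpen_chartBall (hb.trans inter_subset_left)).mem_nhds
    (mem_chartBall (m := m) hr)] with x hx hxb
  obtain ⟨q, hq, rfl⟩ := hxb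
  rw [← hx, h2 q hq]

/-- The 1-jet at `P` of a germ. -/
def germJet (D : AffineConnection m M) (μ : ℝ) (P : M) :
    D.germSolutions μ P →ₗ[ℝ] ℝ × (TangentSpace (𝓡 m) P →L[ℝ] ℝ) where
  toFun φ := (φ.1.value, φ.1.liftOn (fun f ↦ mvfderiv (𝓡 m) f P) fun _ _ h ↦ mvfderiv_congr h)
  map_add' := by
    rintro ⟨_, U, f, hU, hPU, hf, hfE, rfl⟩ ⟨_, V, g, hV, hPV, hg, hgE, rfl⟩
    refine Prod.ext rfl ?_
    exact mvfderiv_add ((hf.contMDiffAt (hU.mem_nhds hPU)).mdifferentiableAt (by simp))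
      ((hg.contMDiffAt (hV.mem_nhds hPV)).mdifferentiableAt (by simp))
  map_smul' := by
    rintro c ⟨_, U, f, hU, hPU, hf, hfE, rfl⟩
    refine Prod.ext rfl ?_
    have := mvfderiv_smul (I := 𝓡 m) (a := fun _ : M ↦ c) (x := P)
      (mdifferentiableAt_const (c := c))
      ((hf.contMDiffAt (hU.mem_nhds hPU)).mdifferentiableAt (by simp))
    rw [mvfderiv_const] at this
    refine Eq.trans this ?_
    simp
    rfl

lemma germJet_injective (D : AffineConnection m M) (μ : ℝ) (P : M) :
    Function.Injective (D.germJet μ P) := by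
  rw [← LinearMap.ker_eq_bot, LinearMap.ker_eq_bot']
  rintro ⟨φ, hφ⟩ h
  induction φ using Germ.inductionOn with
  | h f =>
    have := eventually_eq_zero_of_germ hφ (congrArg Prod.fst h) (congrArg Prod.snd h)
    exact Subtype.ext (Germ.coe_eq.2 this)

/-- The 1-jet embeds the germs into ℝ × T*_P M, of dimension 1 + m. -/
theorem finiteDimensional_germSolutions (D : AffineConnection m M) (μ : ℝ) (P : M) :
    FiniteDimensional ℝ (D.germSolutions μ P) ∧
      Module.finrank ℝ (D.germSolutions μ P) ≤ m + 1 := by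
  let J : D.germSolutions μ P →ₗ[ℝ] ℝ × (Coord m →L[ℝ] ℝ) := D.germJet μ P
  have hJ : Function.Injective J := D.germJet_injective μ P
  refine ⟨FiniteDimensional.of_injective J hJ, ?_⟩
  refine (LinearMap.finrank_le_finrank_of_injective hJ).trans ?_
  rw [Module.finrank_prod, ← (LinearMap.toContinuousLinearMap
    (𝕜 := ℝ) (E := Coord m) (F' := ℝ)).finrank_eq, Module.finrank_linearMap]
  simp [add_comm]

/-- The coordinate form of the equation satisfied by an affine Killing field. -/
lemma isKillingAt_hat {X : Π x : M, TangentSpace (𝓡 m) x} (hU : IsOpen U)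
    (hX : ContMDiffOn (𝓡 m) ((𝓡 m).prod (𝓡 m)) ∞ (fun x ↦ (X x : TangentBundle (𝓡 m) M)) U)
    (hK : ∀ V : Set M, IsOpen V → V ⊆ U → ∀ Y Z : Π x : M, TangentSpace (𝓡 m) x,
      ContMDiffOn (𝓡 m) ((𝓡 m).prod (𝓡 m)) ∞ (fun x ↦ (Y x : TangentBundle (𝓡 m) M)) V →
      ContMDiffOn (𝓡 m) ((𝓡 m).prod (𝓡 m)) ∞ (fun x ↦ (Z x : TangentBundle (𝓡 m) M)) V →
      ∀ x ∈ V, mlieBracket (𝓡 m) X (D.nabla Y Z) x =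
        D.nabla (mlieBracket (𝓡 m) X Y) Z x + D.nabla Y (mlieBracket (𝓡 m) X Z) x)
    (hy : y ∈ (extChartAt (𝓡 m) P).source) (hyU : y ∈ U) :
    FlatConnection.IsKillingAt (christoffel D P) (hat P X) (extChartAt (𝓡 m) P y) := by
  intro v w
  have hfr (w : Coord m) : ContMDiffOn (𝓡 m) ((𝓡 m).prod (𝓡 m)) ∞
      (fun x ↦ (frame P w x : TangentBundle (𝓡 m) M)) (U ∩ (extChartAt (𝓡 m) P).source) :=
    fun z hz ↦ (contMDiffAt_frame hz.2 w).contMDiffWithinAt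
  have hXs : SmoothAt X y := by
    filter_upwards [hU.mem_nhds hyU] with z hz using hX.contMDiffAt (hU.mem_nhds hz)
  -- Testing on coordinate fields suffices: their components are constant, so only derivatives of X
  -- and Γ survive.
  have h := congrArg (coordAt P y) (hK _ (hU.inter (isOpen_extChartAt_source P)) inter_subset_left
    _ _ (hfr v) (hfr w) y ⟨hyU, hy⟩)
  have hs (w : Coord m) := smoothAt_frame hy w
  have hp := (extChartAt (𝓡 m) P).map_source hy
  have hc (w : Coord m) : hat P (frame P w) =ᶠ[𝓝 (extChartAt (𝓡 m) P y)] fun _ ↦ w := by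
    filter_upwards [eventually_mem_target hp] with q hq using hat_frame hq w
  have hX' := hXs.contDiffAt_hat hy
  have hX'' := (hX'.of_le (m := 2) ENat.LEInfty.out).differentiableAt_fderiv
  have hΓ := (contDiffAt_christoffel D hy).differentiableAt (by simp)
  have hb (w : Coord m) : hat P (mlieBracket (𝓡 m) X (frame P w))
      =ᶠ[𝓝 (extChartAt (𝓡 m) P y)] fun q ↦ - fderiv ℝ (hat P X) q w := by
    filter_upwards [hat_mlieBracket_eventuallyEq hXs (hs w) hy, (hc w).eventuallyEq_nhds]
      with q hq hcq
    rw [hq, lieBracket, hcq.fderiv_eq, hcq.self_of_nhds]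
    simp
  have hn : hat P (D.nabla (frame P v) (frame P w)) =ᶠ[𝓝 (extChartAt (𝓡 m) P y)]
      fun q ↦ christoffel D P q w v := by
    filter_upwards [hat_nabla_eventuallyEq (X := frame P v) D (hs w) hy,
      (hc w).eventuallyEq_nhds, hc v] with q hq hcq hv
    rw [hq, FlatConnection.nabla, hcq.fderiv_eq, hcq.self_of_nhds, hv]
    simp
  have hd1 : fderiv ℝ (fun q ↦ christoffel D P q w v) (extChartAt (𝓡 m) P y)
      (hat P X (extChartAt (𝓡 m) P y)) = fderiv ℝ (christoffel D P) (extChartAt (𝓡 m) P y)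
      (hat P X (extChartAt (𝓡 m) P y)) w v := by
    have := ((hΓ.hasFDerivAt.clm_apply (hasFDerivAt_const w _)).clm_apply
      (hasFDerivAt_const v _)).fderiv
    rw [this]
    simp
  have hd2 : fderiv ℝ (fun q ↦ - fderiv ℝ (hat P X) q w) (extChartAt (𝓡 m) P y) v =
      - fderiv ℝ (fderiv ℝ (hat P X)) (extChartAt (𝓡 m) P y) v w := by
    have := (hX''.hasFDerivAt.clm_apply (hasFDerivAt_const w _)).neg.fderiv
    refine (congrArg (fun L : Coord m →L[ℝ] Coord m ↦ L v) this).trans ?_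
    simp
  rw [map_add, coordAt_mlieBracket hXs (.nabla D (hs v) (hs w)) hy, coordAt_nabla D (hs w) hy,
    coordAt_nabla D (hXs.mlieBracket (hs w)) hy, lieBracket, hn.fderiv_eq, hn.self_of_nhds,
    FlatConnection.nabla, FlatConnection.nabla, (hc w).fderiv_eq, (hb w).fderiv_eq,
    (hb v).self_of_nhds, (hb w).self_of_nhds, (hc v).self_of_nhds, (hc w).self_of_nhds, hd1,
    hd2] at h
  simp only [map_neg, neg_apply, fderiv_fun_const, Pi.zero_apply, zero_apply] at h
  rw [sub_eq_iff_eq_add] at h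
  rw [h]
  abel

/-- Affine Killing fields preserve the space of germs of solutions. -/
theorem killing_mem_germSolutions {X : Π x : M, TangentSpace (𝓡 m) x}
    (hX : D.IsAffineKillingNear X P) (hf : (f : Germ (𝓝 P) ℝ) ∈ D.germSolutions μ P) :
    ((fun x ↦ mvfderiv (𝓡 m) f x (X x) : M → ℝ) : Germ (𝓝 P) ℝ) ∈ D.germSolutions μ P := by
  obtain ⟨U, hU, hPU, hXU, hK⟩ := hX
  obtain ⟨V, g, hV, hPV, hg, hgE, hgf⟩ := mem_germSolutions_iff.1 hf
  have := isManifold_two (m := m) (M := M)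
  let W : Set M := U ∩ V ∩ (extChartAt (𝓡 m) P).source
  have hW : IsOpen W := (hU.inter hV).inter (isOpen_extChartAt_source P)
  set s := (extChartAt (𝓡 m) P).target ∩ (extChartAt (𝓡 m) P).symm ⁻¹' W
  have hs : IsOpen s := isOpen_target_inter (m := m) P hW
  have hys {y : M} (hy : y ∈ W) : extChartAt (𝓡 m) P y ∈ s :=
    ⟨(extChartAt (𝓡 m) P).map_source hy.2, by rwa [mem_preimage, PartialEquiv.left_inv _ hy.2]⟩
  let h : M → ℝ := fun x ↦ mvfderiv (𝓡 m) g x (X x)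
  have hh : EqOn (h ∘ (extChartAt (𝓡 m) P).symm) (fun q ↦
      fderiv ℝ (g ∘ (extChartAt (𝓡 m) P).symm) q (hat P X q)) s := by
    intro q hq
    change mvfderiv (𝓡 m) g _ _ = _
    rw [mvfderiv_eq hq.2.2 ((hg.contMDiffAt (hV.mem_nhds hq.2.1.2)).mdifferentiableAt (by simp)),
      PartialEquiv.right_inv _ hq.1]
    rfl
  have hΓs := (contDiffOn_christoffel_infty D P).mono (inter_subset_left : s ⊆ _)
  have hXs : ContDiffOn ℝ ∞ (hat P X) s := fun q hq ↦ by
    have := (contMDiffAt_section_iff_hat hq.2.2).1 (hXU.contMDiffAt (hU.mem_nhds hq.2.1.1))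
    rw [PartialEquiv.right_inv _ hq.1] at this
    exact this.contDiffWithinAt
  have hgs : ContDiffOn ℝ ∞ (g ∘ (extChartAt (𝓡 m) P).symm) s := fun q hq ↦
    (contDiffAt_comp_symm hV hg ⟨hq.1, hq.2.1.2⟩).contDiffWithinAt
  have hKs : ∀ q ∈ s, FlatConnection.IsKillingAt (christoffel D P) (hat P X) q := fun q hq ↦ by
    have := isKillingAt_hat hU hXU hK hq.2.2 hq.2.1.1
    rwa [PartialEquiv.right_inv _ hq.1] at this
  have hEs : ∀ q ∈ s, FlatConnection.IsSolutionAt μ (christoffel D P)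
      (g ∘ (extChartAt (𝓡 m) P).symm) q := fun q hq ↦
    hgE.isSolutionAt hV (hg.of_le ENat.LEInfty.out) ⟨hq.1, hq.2.1.2⟩
  have hhs : ContDiffOn ℝ ∞ (h ∘ (extChartAt (𝓡 m) P).symm) s :=
    ((hgs.fderiv_of_isOpen hs (m := ∞) (by simp)).clm_apply hXs).congr hh
  have hhW : ContMDiffOn (𝓡 m) 𝓘(ℝ, ℝ) ∞ h W := fun y hy ↦
    ((contDiffAt_comp_symm_iff hy.2).2
      (hhs.contDiffAt (hs.mem_nhds (hys hy)))).contMDiffWithinAt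
  refine mem_germSolutions_iff.2 ⟨W, h, hW, ⟨⟨hPU, hPV⟩, mem_extChartAt_source P⟩, hhW, ?_, ?_⟩
  · intro y hy
    refine (isSolutionAt_iff D μ hy.2
      ((hhW.contMDiffAt (hW.mem_nhds hy)).of_le ENat.LEInfty.out)).2 ?_
    have hsol := FlatConnection.IsSolutionAt.killing hs (hys hy) hΓs hXs hgs hKs hEs
    have he := hh.eventuallyEq_of_mem (hs.mem_nhds (hys hy))
    intro v w
    rw [he.fderiv.fderiv_eq, he.fderiv_eq, he.self_of_nhds]
    exact hsol v w
  · filter_upwards [hgf.eventuallyEq_nhds] with x hx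
    exact congrArg (fun L : TangentSpace (𝓡 m) x →L[ℝ] ℝ ↦ L (X x)) (mvfderiv_congr hx)

end AffineConnection

end

/-! ### Local systems of functions on simply connected spaces -/

/-- A locally constant family of local functions on a simply connected space, which is
parametrized near every point by a fixed set, has global members with any prescribed germ. -/
theorem exists_global_of_germs {X β F : Type*} [TopologicalSpace X] [SimplyConnectedSpace X]
    [LocallyPathConnectedSpace X] {V : X → Set X} (hVo : ∀ x, IsOpen (V x))
    (hV : ∀ x, x ∈ V x) {s : X → F → X → β} {G : ∀ x, Set (Germ (𝓝 x) β)}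
    (hs : ∀ Q, ∀ x ∈ V Q, BijOn (fun c ↦ (s Q c : Germ (𝓝 x) β)) univ (G x)) {P : X}
    {φ : Germ (𝓝 P) β} (hφ : φ ∈ G P) :
    ∃ f : X → β, (f : Germ (𝓝 P) β) = φ ∧ ∀ x, (f : Germ (𝓝 x) β) ∈ G x := by
  have hinj {Q x : X} {c c' : F} (hx : x ∈ V Q) (h : s Q c =ᶠ[𝓝 x] s Q c') : c = c' :=
    (hs Q x hx).injOn (mem_univ _) (mem_univ _) (Germ.coe_eq.2 h)
  have hex (Q R x : X) (c : F) (hx : x ∈ V Q ∩ V R) : ∃ c', s R c' =ᶠ[𝓝 x] s Q c := by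
    obtain ⟨c', -, h⟩ := (hs R x hx.2).surjOn ((hs Q x hx.1).mapsTo (mem_univ c))
    exact ⟨c', Germ.coe_eq.1 h⟩
  obtain ⟨c₀, -, hc₀⟩ := (hs P P (hV P)).surjOn hφ
  -- κ Q R x c is the parameter at R of the member whose germ at x agrees with that of s Q c. By
  -- `hinj` it is unique, which gives the cocycle identities.
  choose! κ hκ using hex
  -- With discrete fibre the bundle glued from κ is a covering space, whose points over x stand for
  -- the germs in G x.
  let _ : TopologicalSpace F := ⊥
  have _ : DiscreteTopology F := ⟨rfl⟩
  let Z : FiberBundleCore X X F :=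
    { baseSet := V
      isOpen_baseSet := hVo
      indexAt := id
      mem_baseSet_at := hV
      coordChange := κ
      coordChange_self := fun Q x hx c ↦ hinj hx (hκ Q Q x c ⟨hx, hx⟩)
      continuousOn_coordChange := fun Q R ↦ by
        rw [continuousOn_prod_of_discrete_right]
        intro c x hx
        have hx' : x ∈ V Q ∩ V R := hx.1
        refine (continuousAt_const.congr
          (f := fun _ ↦ κ Q R x c) ?_).continuousWithinAt
        -- Agreement of germs at x persists at nearby y, so by uniqueness κ is locally constant in
        -- the base point.
        filter_upwards [(hκ Q R x c hx').eventuallyEq_nhds,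
          ((hVo Q).inter (hVo R)).mem_nhds hx'] with y hy hyV
        exact hinj hyV.2 (hy.trans (hκ Q R y c hyV).symm)
      coordChange_comp := fun Q R S x hx c ↦ hinj hx.2 <|
        (hκ R S x _ ⟨hx.1.2, hx.2⟩).trans <| (hκ Q R x c hx.1).trans
          (hκ Q S x c ⟨hx.1.1, hx.2⟩).symm }
  have hcov : IsCoveringMap (Z.proj) := FiberBundle.isCoveringMap (F := F) (E := Z.Fiber)
  -- Since X is simply connected, its identity map lifts to the covering: this is a section through
  -- the prescribed germ.
  obtain ⟨σ, ⟨hσP, hσ⟩, -⟩ := hcov.existsUnique_continuousMap_lifts (ContinuousMap.id X) P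
    (⟨P, c₀⟩ : Z.TotalSpace) rfl
  have hp (x : X) : (σ x).1 = x := congrFun hσ x
  let f : X → β := fun x ↦ s x (σ x).2 x
  have hf (x : X) : f =ᶠ[𝓝 x] s x (σ x).2 := by
    have hcont : ContinuousAt (fun y ↦ ((Z.localTriv x) (σ y)).2) x := by
      have h1 := (Z.localTriv x).continuousAt (x := σ x) (by
        rw [Z.mem_localTriv_source]; rw [hp]; exact hV x)
      exact continuousAt_snd.comp (h1.comp σ.continuous.continuousAt)
    -- A continuous map into a discrete fibre is locally constant, so near x all values of σ
    -- represent the single function s x (σ x).2.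
    have hlc : ∀ᶠ y in 𝓝 x, ((Z.localTriv x) (σ y)).2 = ((Z.localTriv x) (σ x)).2 :=
      hcont.eventually (discreteTopology_iff_singleton_mem_nhds.1 ‹_› _)
    have hval {y : X} : ((Z.localTriv x) (σ y)).2 = κ y x y (σ y).2 := by
      change κ (σ y).1 x (σ y).1 (σ y).2 = _
      rw [hp]
    filter_upwards [hlc, (hVo x).mem_nhds (hV x)] with y hy hyV
    rw [hval, hval, hinj (hV x) (hκ x x x (σ x).2 ⟨hV x, hV x⟩)] at hy
    exact hy ▸ (hκ y x y (σ y).2 ⟨hV y, hyV⟩).self_of_nhds.symm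
  refine ⟨f, ?_, fun x ↦ ?_⟩
  · rw [← hc₀, Germ.coe_eq]
    have := hf P
    rwa [hσP] at this
  · rw [Germ.coe_eq.2 (hf x)]
    exact (hs x x (hV x)).mapsTo (mem_univ _)

/-! ### Global extension of germs of solutions -/

noncomputable section

namespace AffineConnection

variable {m : ℕ} {M : Type*} [TopologicalSpace M] [ChartedSpace (Coord m) M]
  [IsManifold (𝓡 m) ∞ M] {P x : M} {μ : ℝ} {D : AffineConnection m M} {f g : M → ℝ} {U : Set M}

lemma hessian_congr (h : f =ᶠ[𝓝 x] g) (v w : TangentSpace (𝓡 m) x) :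
    D.hessian f x v w = D.hessian g x v w := by
  have h1 : (fun y ↦ mvfderiv (𝓡 m) f y (constField w y)) =ᶠ[𝓝 x]
      fun y ↦ mvfderiv (𝓡 m) g y (constField w y) := by
    filter_upwards [h.eventuallyEq_nhds] with y hy
    rw [mvfderiv_congr hy]
  rw [hessian, hessian, mvfderiv_congr h1, mvfderiv_congr h]

/-- The space of `C^2` solutions of the quasi-Einstein equation on an open set. -/
def solutionsOn (D : AffineConnection m M) (μ : ℝ) (hU : IsOpen U) : Submodule ℝ (M → ℝ) where
  carrier := {f | ContMDiffOn (𝓡 m) 𝓘(ℝ, ℝ) 2 f U ∧ D.QuasiEinsteinOn μ f U}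
  add_mem' hf hg := ⟨hf.1.add hg.1, .add hU hf.1 hg.1 hf.2 hg.2⟩
  zero_mem' := ⟨contMDiffOn_const, .zero D μ U⟩
  smul_mem' c _ hf := ⟨(contDiff_const_smul c).contMDiff.comp_contMDiffOn hf.1,
    .smul c hU hf.1 hf.2⟩

/-- Passage to the germ at a point. -/
def toGerm (x : M) : (M → ℝ) →ₗ[ℝ] Germ (𝓝 x) ℝ where
  toFun f := f
  map_add' _ _ := rfl
  map_smul' _ _ := rfl

lemma toGerm_mem_germSolutions {hU : IsOpen U} (hf : f ∈ D.solutionsOn μ hU) (hx : x ∈ U) :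
    toGerm x f ∈ D.germSolutions μ x :=
  ⟨U, f, hU, hx, hf.2.contMDiffOn_infty hU hf.1, hf.2, rfl⟩

/-- A basis of the germs of solutions at a point is represented by solutions on a common
preconnected open neighbourhood. -/
lemma exists_local_basis (D : AffineConnection m M) (μ : ℝ) (P : M) {d : ℕ}
    (hd : Module.finrank ℝ (D.germSolutions μ P) = d) :
    ∃ (V : Set M) (hV : IsOpen V) (g : Fin d → M → ℝ), IsPreconnected V ∧ P ∈ V ∧
      (∀ i, g i ∈ D.solutionsOn μ hV) ∧ LinearIndependent ℝ fun i ↦ toGerm P (g i) := by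
  have := (finiteDimensional_germSolutions D μ P).1
  let b := Module.finBasisOfFinrankEq ℝ (D.germSolutions μ P) hd
  choose U g hU hPU hg hgE hgb using fun i ↦ (b i).2
  obtain ⟨r, hr, hb⟩ := exists_ball_subset (m := m) (P := P)
    (iInter_mem.2 fun i ↦ (hU i).mem_nhds (hPU i))
  have hbt := hb.trans inter_subset_left
  have hV : ∀ i, chartBall (m := m) P r ⊆ U i := by
    rintro i _ ⟨q, hq, rfl⟩
    exact mem_iInter.1 (interior_subset (hb hq).2) i
  refine ⟨chartBall (m := m) P r, isOpen_chartBall hbt, g, isPreconnected_chartBall hbt,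
    mem_chartBall hr, fun i ↦ ⟨((hg i).mono (hV i)).of_le ENat.LEInfty.out,
      fun x hx ↦ hgE i x (hV i hx)⟩, ?_⟩
  have h := b.linearIndependent.map' (D.germSolutions μ P).subtype (Submodule.ker_subtype _)
  exact (funext hgb : (fun i ↦ toGerm P (g i)) = _) ▸ h

/-- If the dimension of the space of germs of solutions is constant, the solutions which form a
basis at one point form a basis at all points of a preconnected neighbourhood. -/
lemma bijOn_germSolutions {d : ℕ} (hd : ∀ Q : M, Module.finrank ℝ (D.germSolutions μ Q) = d)
    {V : Set M} {hV : IsOpen V} {g : Fin d → M → ℝ} (hVc : IsPreconnected V) (hP : P ∈ V)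
    (hg : ∀ i, g i ∈ D.solutionsOn μ hV) (hli : LinearIndependent ℝ fun i ↦ toGerm P (g i))
    (hx : x ∈ V) :
    BijOn (fun c ↦ (Fintype.linearCombination ℝ g c : Germ (𝓝 x) ℝ)) univ
      (D.germSolutions μ x) := by
  have hmem (c : Fin d → ℝ) : Fintype.linearCombination ℝ g c ∈ D.solutionsOn μ hV := by
    rw [Fintype.linearCombination_apply]
    exact Submodule.sum_mem _ fun i _ ↦ Submodule.smul_mem _ _ (hg i)
  let T : (Fin d → ℝ) →ₗ[ℝ] D.germSolutions μ x :=
    (toGerm x ∘ₗ Fintype.linearCombination ℝ g).codRestrict _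
      fun c ↦ toGerm_mem_germSolutions (hmem c) hx
  -- A combination vanishing near x vanishes on all of V by unique continuation, in particular near
  -- P, where the germs are independent.
  have hT : Function.Injective T := by
    rw [← LinearMap.ker_eq_bot, LinearMap.ker_eq_bot']
    intro c hc
    have h1 : ∀ᶠ y in 𝓝 x, Fintype.linearCombination ℝ g c y = 0 :=
      Germ.coe_eq.1 (congrArg Subtype.val hc)
    have h2 := (hmem c).2.eq_zero_of_isPreconnected hV (hmem c).1 hVc Subset.rfl hx h1
    have h3 : toGerm P (Fintype.linearCombination ℝ g c) = 0 :=
      Germ.coe_eq.2 (mem_of_superset (hV.mem_nhds hP) h2)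
    rw [Fintype.linearCombination_apply, map_sum] at h3
    simp only [map_smul] at h3
    exact funext (Fintype.linearIndependent_iff.1 hli c h3)
  have := (finiteDimensional_germSolutions D μ x).1
  -- Constancy of the dimension enters here: source and target both have dimension d, so injectivity
  -- forces surjectivity.
  have hTs := (LinearMap.injective_iff_surjective_of_finrank_eq_finrank
    (by rw [hd, Module.finrank_fin_fun])).1 hT
  refine ⟨fun c _ ↦ (T c).2, fun c _ c' _ h ↦ hT (Subtype.ext h), fun φ hφ ↦ ?_⟩
  obtain ⟨c, hc⟩ := hTs ⟨φ, hφ⟩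
  exact ⟨c, mem_univ c, congrArg Subtype.val hc⟩

/-- A function whose germs are germs of solutions is a solution. -/
lemma mem_solutions_of_germ (h : ∀ x, (f : Germ (𝓝 x) ℝ) ∈ D.germSolutions μ x) :
    f ∈ D.solutions μ := by
  refine ⟨fun x ↦ ?_, fun x _ v w ↦ ?_⟩ <;>
    obtain ⟨U, g, hU, hxU, hg, hgE, hgf⟩ := mem_germSolutions_iff.1 (h x)
  · exact ((hg.contMDiffAt (hU.mem_nhds hxU)).of_le ENat.LEInfty.out).congr_of_eventuallyEq
      hgf.symm
  · rw [hessian_congr hgf.symm, hgE x hxU, hgf.self_of_nhds]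

lemma eq_of_mem_solutions [PreconnectedSpace M] (hf : f ∈ D.solutions μ) (hg : g ∈ D.solutions μ)
    (h : f =ᶠ[𝓝 P] g) : f = g := by
  have hfg := Submodule.sub_mem _ hf hg
  refine funext fun x ↦ sub_eq_zero.1 ?_
  exact hfg.2.eq_zero_of_isPreconnected isOpen_univ hfg.1.contMDiffOn isPreconnected_univ
    Subset.rfl (mem_univ P) (h.mono fun y hy ↦ sub_eq_zero.2 hy) x (mem_univ x)

/-- On a simply connected manifold, if the dimension of the space of germs of solutions is
constant, every germ of a solution extends uniquely to a global solution. -/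
theorem existsUnique_solutions [SimplyConnectedSpace M] {d : ℕ}
    (hd : ∀ Q : M, Module.finrank ℝ (D.germSolutions μ Q) = d) {φ : Germ (𝓝 P) ℝ}
    (hφ : φ ∈ D.germSolutions μ P) :
    ∃! F : M → ℝ, F ∈ D.solutions μ ∧ (F : Germ (𝓝 P) ℝ) = φ := by
  have := ChartedSpace.locallyPathConnectedSpace (Coord m) M
  choose V hVo g hVc hV hg hli using fun Q ↦ D.exists_local_basis μ Q (hd Q)
  obtain ⟨F, hFP, hF⟩ := exists_global_of_germs hVo hV
    (s := fun Q ↦ Fintype.linearCombination ℝ (g Q)) (G := fun x ↦ D.germSolutions μ x)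
    (fun Q x hx ↦ bijOn_germSolutions hd (hVc Q) (hV Q) (hg Q) (hli Q) hx) hφ
  refine ⟨F, ⟨mem_solutions_of_germ hF, hFP⟩, fun F' hF' ↦ ?_⟩
  exact eq_of_mem_solutions hF'.1 (mem_solutions_of_germ hF) (Germ.coe_eq.1 (hF'.2.trans hFP.symm))

end AffineConnection

end

end

theorem theorem1p1 {m : ℕ} {M : Type*} [TopologicalSpace M] [T2Space M]
    [SecondCountableTopology M] [ChartedSpace (Coord m) M] [IsManifold (𝓡 m) ∞ M]
    (D : AffineConnection m M) (μ : ℝ) :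
    -- (1) a `C^2` solution on an open set `U` is smooth
    (∀ (U : Set M) (f : M → ℝ), IsOpen U → ContMDiffOn (𝓡 m) 𝓘(ℝ, ℝ) 2 f U →
      D.QuasiEinsteinOn μ f U → ContMDiffOn (𝓡 m) 𝓘(ℝ, ℝ) ∞ f U) ∧
    -- and it is real analytic if the structure is real analytic
    (IsManifold (𝓡 m) ω M → D.IsAnalytic →
      ∀ (U : Set M) (f : M → ℝ), IsOpen U → ContMDiffOn (𝓡 m) 𝓘(ℝ, ℝ) 2 f U →
        D.QuasiEinsteinOn μ f U → ContMDiffOn (𝓡 m) 𝓘(ℝ, ℝ) ω f U) ∧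
    -- (2) affine Killing fields preserve the space of germs of solutions
    (∀ (P : M) (X : Π x : M, TangentSpace (𝓡 m) x), D.IsAffineKillingNear X P →
      ∀ f : M → ℝ, (f : Germ (𝓝 P) ℝ) ∈ D.germSolutions μ P →
        ((fun x ↦ mvfderiv (𝓡 m) f x (X x) : M → ℝ) : Germ (𝓝 P) ℝ) ∈ D.germSolutions μ P) ∧
    -- (3) a germ of a solution with vanishing 1-jet at `P` vanishes near `P`
    (∀ (P : M) (f : M → ℝ), (f : Germ (𝓝 P) ℝ) ∈ D.germSolutions μ P →
      f P = 0 → mvfderiv (𝓡 m) f P = 0 → ∀ᶠ x in 𝓝 P, f x = 0) ∧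
    -- (4) the dimension bound
    (∀ P : M, FiniteDimensional ℝ (D.germSolutions μ P) ∧
      Module.finrank ℝ (D.germSolutions μ P) ≤ m + 1) ∧
    -- (5) unique extension to a global solution
    (SimplyConnectedSpace M →
      (∃ d : ℕ, ∀ Q : M, Module.finrank ℝ (D.germSolutions μ Q) = d) →
      ∀ (P : M), ∀ φ ∈ D.germSolutions μ P,
        ∃! F : M → ℝ, F ∈ D.solutions μ ∧ (F : Germ (𝓝 P) ℝ) = φ) := by
  refine ⟨fun U f hU hf h ↦ h.contMDiffOn_infty hU hf, fun _ hD U f hU hf h ↦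
    h.contMDiffOn_omega hD hU hf,
    fun P X hX f hf ↦ AffineConnection.killing_mem_germSolutions hX hf,
    fun P f hf h0 h1 ↦ AffineConnection.eventually_eq_zero_of_germ hf h0 h1,
    D.finiteDimensional_germSolutions μ, ?_⟩
  rintro _ ⟨d, hd⟩ P φ hφ
  exact AffineConnection.existsUnique_solutions hd hφ
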